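/- Let $\mathfrak{osp}(1|2)$ be the complex Lie superalgebra with basis $x_{-2\alpha},x_{-\alpha},h,x_\alpha,x_{2\alpha}$ ($x_{\pm\alpha}$ odd, the others even) and superbrackets $[h,x_{\pm k\alpha}]=\mp k\,x_{\pm k\alpha}$, $[x_{-k\alpha},x_{k\alpha}]=h$ for $k\in\{1,2\}$, $[x_{\pm\alpha},x_{\pm\alpha}]=\mp 2x_{\pm2\alpha}$, $[x_{\pm\alpha},x_{\mp2\alpha}]=x_{\mp\alpha}$, $[x_{\pm2\alpha},x_{\pm\alpha}]=0$. Put $\mathfrak n_\pm=\mathbb C x_{\pm2\alpha}\oplus\mathbb C x_{\pm\alpha}$. A primitive vector of a representation is a vector annihilated by $\mathfrak n_+$; a highest weight vector is a nonzero primitive eigenvector of $h$. Let $\mathbb C[x]=V(\tfrac12)$ be the polynomial representation: $x_{-\alpha}=\tfrac12x$, $x_\alpha=\tfrac{d}{dx}$, $x_{-2\alpha}=\tfrac14x^2$, $x_{2\alpha}=-\tfrac{d^2}{dx^2}$, $h=x\tfrac{d}{dx}+\tfrac12$, graded by the parity of the degree, with highest weight vector $1$. Let $\ell\ge0$ be an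 integer and let $V(-\ell)$ be an irreducible representation of $\mathfrak{osp}(1|2)$ on a super vector space of dimension $2\ell+1$, with highest weight vector $v_\ell$. Then $h v_\ell=-\ell v_\ell$. On $\mathbb C[x]\otimes V(-\ell)$ (with the sign rule $(1\otimes y)(p\otimes v)=(-1)^{|y||p|}p\otimes yv$) put $X_\beta=x_\beta\otimes1+1\otimes x_\beta$, $\tilde x_\beta=x_\beta\otimes1-1\otimes x_\beta$, $H=h\otimes1+1\otimes h$, $\tilde h=h\otimes1-1\otimes h$; elements of $\mathfrak{osp}(1|2)$ act on the tensor product by $y\otimes 1+1\otimes y$. Then $H-1$ and $H-2$ are invertible on $\mathbb C[x]\otimes V(-\ell)$, and with $$T=\tilde x_{-\alpha}-\frac1{H-1}X_{-\alpha}\tilde h-\frac1{H-1}X_{-\alpha}^2\tilde x_\alpha-\frac2{(H-2)(H-1)}X_{-\alpha}^3\tilde x_{2\alpha}$$ the vectors $T^j(1\otimes v_\ell)$, $0\le j\le2\ell$, are nonzero and primitive, each $U(\mathfrak n_-)\,T^j(1\otimes v_\ell)$ is an irreducible subrepresentation, and $$\mathbb C[x]\otimes V(-\ell)=\bigoplus_{j=0}^{2\ell}U(\mathfrak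 n_-)\,T^j(1\otimes v_\ell).$$ -/

import Mathlib

open TensorProduct Polynomial

set_option linter.unusedSimpArgs false
set_option linter.unusedVariables false

noncomputable section

/-- The Koszul sign `(-1)^{ij}`, for `i j ∈ ℤ/2`. -/
def koszulSign (i j : ZMod 2) : ℂ := if i = 1 ∧ j = 1 then -1 else 1

theorem koszulSign_zero_left (j : ZMod 2) : koszulSign 0 j = 1 := by simp [koszulSign]
theorem koszulSign_zero_right (i : ZMod 2) : koszulSign i 0 = 1 := by simp [koszulSign]
theorem koszulSign_comm (i j : ZMod 2) : koszulSign i j = koszulSign j i := by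
  simp [koszulSign, and_comm]
theorem koszulSign_one_one : koszulSign 1 1 = -1 := by simp [koszulSign]
theorem zmod_two_cases : ∀ i : ZMod 2, i = 0 ∨ i = 1 := by decide
theorem zmod_two_one_add_one : (1 + 1 : ZMod 2) = 0 := by decide

/-! ### Lie superalgebras, representations, universal enveloping algebras -/

/-- Complex Lie superalgebras: a `ℤ/2`-grading and a graded bilinear bracket that is
super-antisymmetric and satisfies the super Jacobi identity. -/
class LieSuperalgebra (𝔤 : Type*) [AddCommGroup 𝔤] [Module ℂ 𝔤] where
  part : ZMod 2 → Submodule ℂ 𝔤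
  isCompl_part : IsCompl (part 0) (part 1)
  bracket : 𝔤 →ₗ[ℂ] 𝔤 →ₗ[ℂ] 𝔤
  bracket_mem : ∀ {i j : ZMod 2} {x y : 𝔤}, x ∈ part i → y ∈ part j → bracket x y ∈ part (i + j)
  bracket_skew : ∀ {i j : ZMod 2} {x y : 𝔤}, x ∈ part i → y ∈ part j →
    bracket x y = -(koszulSign i j • bracket y x)
  jacobi : ∀ {i j : ZMod 2} {x y z : 𝔤}, x ∈ part i → y ∈ part j →
    bracket x (bracket y z) =
      bracket (bracket x y) z + koszulSign i j • bracket y (bracket x z)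

namespace LieSuperalgebra

variable (𝔤 : Type*) [AddCommGroup 𝔤] [Module ℂ 𝔤] [LieSuperalgebra 𝔤]

/-- Projection of `𝔤` onto its even part. -/
def evenProj : 𝔤 →ₗ[ℂ] 𝔤 := (part (𝔤 := 𝔤) 0).projection (part 1) isCompl_part

/-- Projection of `𝔤` onto its odd part. -/
def oddProj : 𝔤 →ₗ[ℂ] 𝔤 := (part (𝔤 := 𝔤) 1).projection (part 0) isCompl_part.symm

/-- The defining relations `x y - (-1)^{|x||y|} y x = [x, y]` of `U(𝔤)`. -/
inductive EnvRel : TensorAlgebra ℂ 𝔤 → TensorAlgebra ℂ 𝔤 → Prop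
  | bracket {i j : ZMod 2} {x y : 𝔤} (hx : x ∈ part i) (hy : y ∈ part j) :
      EnvRel
        (TensorAlgebra.ι ℂ x * TensorAlgebra.ι ℂ y
          - koszulSign i j • (TensorAlgebra.ι ℂ y * TensorAlgebra.ι ℂ x))
        (TensorAlgebra.ι ℂ (LieSuperalgebra.bracket x y))

/-- The universal enveloping algebra `U(𝔤)` of a Lie superalgebra. -/
abbrev Env : Type _ := RingQuot (EnvRel 𝔤)

/-- The canonical map `𝔤 → U(𝔤)`. -/
def Env.ι : 𝔤 →ₗ[ℂ] Env 𝔤 :=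
  (RingQuot.mkAlgHom ℂ (EnvRel 𝔤)).toLinearMap ∘ₗ TensorAlgebra.ι ℂ

end LieSuperalgebra

open LieSuperalgebra

/-- A representation of a Lie superalgebra on a super vector space with underlying space `V`. -/
structure SuperRep (𝔤 : Type*) [AddCommGroup 𝔤] [Module ℂ 𝔤] [LieSuperalgebra 𝔤]
    (V : Type*) [AddCommGroup V] [Module ℂ V] where
  part : ZMod 2 → Submodule ℂ V
  isCompl_part : IsCompl (part 0) (part 1)
  act : 𝔤 →ₗ[ℂ] Module.End ℂ V
  act_mem : ∀ {i j : ZMod 2} {x : 𝔤} {v : V},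
    x ∈ LieSuperalgebra.part i → v ∈ part j → act x v ∈ part (i + j)
  act_bracket : ∀ {i j : ZMod 2} {x y : 𝔤},
    x ∈ LieSuperalgebra.part i → y ∈ LieSuperalgebra.part j →
    act (bracket x y) = act x * act y - koszulSign i j • (act y * act x)

namespace SuperRep

variable {𝔤 : Type*} [AddCommGroup 𝔤] [Module ℂ 𝔤] [LieSuperalgebra 𝔤]
variable {V : Type*} [AddCommGroup V] [Module ℂ V]
variable {W : Type*} [AddCommGroup W] [Module ℂ W]

/-- The parity operator `v ↦ (-1)^{|v|} v`. -/
def parity (ρ : SuperRep 𝔤 V) : Module.End ℂ V :=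
  (ρ.part 0).projection (ρ.part 1) ρ.isCompl_part
    - (ρ.part 1).projection (ρ.part 0) ρ.isCompl_part.symm

/-- The action of `U(𝔤)` on a representation of `𝔤`. -/
def envAct (ρ : SuperRep 𝔤 V) : Env 𝔤 →ₐ[ℂ] Module.End ℂ V :=
  RingQuot.liftAlgHom ℂ ⟨TensorAlgebra.lift ℂ ρ.act, by
    rintro _ _ ⟨hx, hy⟩
    simp [ρ.act_bracket hx hy]⟩

/-- The subspace `S • w = {u w | u ∈ S}`, for a subalgebra `S` of `U(𝔤)` and a vector `w`. -/
def orbit (ρ : SuperRep 𝔤 V) (S : Subalgebra ℂ (Env 𝔤)) (w : V) : Submodule ℂ V :=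
  (Subalgebra.toSubmodule S).map (LinearMap.applyₗ w ∘ₗ ρ.envAct.toLinearMap)

/-- Subrepresentations: graded subspaces that are stable under `𝔤`. -/
def IsSubrep (ρ : SuperRep 𝔤 V) (N : Submodule ℂ V) : Prop :=
  N ≤ (N ⊓ ρ.part 0) ⊔ (N ⊓ ρ.part 1) ∧ ∀ x : 𝔤, ∀ v ∈ N, ρ.act x v ∈ N

/-- `N` is an irreducible subrepresentation. -/
def IsIrreducibleSubrep (ρ : SuperRep 𝔤 V) (N : Submodule ℂ V) : Prop :=
  ρ.IsSubrep N ∧ N ≠ ⊥ ∧ ∀ N' : Submodule ℂ V, ρ.IsSubrep N' → N' ≤ N → N' = ⊥ ∨ N' = N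

/-- Irreducible representations. -/
def IsIrreducible (ρ : SuperRep 𝔤 V) : Prop := ρ.IsIrreducibleSubrep ⊤

/-- The operators `x ⊗ 1` on `V ⊗ W`, for `x ∈ 𝔤`. -/
def actLeft (ρ : SuperRep 𝔤 V) (_σ : SuperRep 𝔤 W) : 𝔤 →ₗ[ℂ] Module.End ℂ (V ⊗[ℂ] W) :=
  (TensorProduct.mapBilinear (RingHom.id ℂ) V W V W).flip 1 ∘ₗ ρ.act

/-- The operators `1 ⊗ x` on `V ⊗ W`, for `x ∈ 𝔤`, with the Koszul sign rule
`(1 ⊗ x)(v ⊗ w) = (-1)^{|x||v|} v ⊗ x w`. -/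
def actRight (ρ : SuperRep 𝔤 V) (σ : SuperRep 𝔤 W) : 𝔤 →ₗ[ℂ] Module.End ℂ (V ⊗[ℂ] W) :=
  TensorProduct.mapBilinear (RingHom.id ℂ) V W V W 1 ∘ₗ σ.act ∘ₗ evenProj 𝔤
    + TensorProduct.mapBilinear (RingHom.id ℂ) V W V W ρ.parity ∘ₗ σ.act ∘ₗ oddProj 𝔤

theorem parity_apply (ρ : SuperRep 𝔤 V) {i : ZMod 2} {v : V} (hv : v ∈ ρ.part i) :
    ρ.parity v = koszulSign i 1 • v := by
  rcases zmod_two_cases i with rfl | rfl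
  · have h1 := Submodule.projection_apply_left ρ.isCompl_part ⟨v, hv⟩
    have h2 := Submodule.projection_apply_right ρ.isCompl_part.symm ⟨v, hv⟩
    simp only at h1 h2
    simp [parity, h1, h2, koszulSign_zero_left, koszulSign_zero_right, koszulSign_one_one,
        zmod_two_one_add_one]
  · have h1 := Submodule.projection_apply_left ρ.isCompl_part.symm ⟨v, hv⟩
    have h2 := Submodule.projection_apply_right ρ.isCompl_part ⟨v, hv⟩
    simp only at h1 h2
    simp [parity, h1, h2, koszulSign_zero_left, koszulSign_zero_right, koszulSign_one_one,
        zmod_two_one_add_one]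

theorem mem_decomp (ρ : SuperRep 𝔤 V) (v : V) :
    ∃ a ∈ ρ.part 0, ∃ b ∈ ρ.part 1, a + b = v :=
  Submodule.mem_sup.1 (ρ.isCompl_part.sup_eq_top ▸ Submodule.mem_top)

theorem actLeft_tmul (ρ : SuperRep 𝔤 V) (σ : SuperRep 𝔤 W) (x : 𝔤) (v : V) (w : W) :
    ρ.actLeft σ x (v ⊗ₜ w) = ρ.act x v ⊗ₜ w := rfl

theorem actRight_tmul (ρ : SuperRep 𝔤 V) (σ : SuperRep 𝔤 W) {i j : ZMod 2} {x : 𝔤} {v : V}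
    (hx : x ∈ LieSuperalgebra.part i) (hv : v ∈ ρ.part j) (w : W) :
    ρ.actRight σ x (v ⊗ₜ w) = koszulSign i j • (v ⊗ₜ σ.act x w) := by
  have hp := ρ.parity_apply hv
  rcases zmod_two_cases i with rfl | rfl
  · have h1 := Submodule.projection_apply_left (LieSuperalgebra.isCompl_part (𝔤 := 𝔤)) ⟨x, hx⟩
    have h2 := Submodule.projection_apply_right (LieSuperalgebra.isCompl_part (𝔤 := 𝔤)).symm ⟨x, hx⟩
    simp only at h1 h2
    simp [actRight, evenProj, oddProj, h1, h2, koszulSign_zero_left, koszulSign_zero_right, koszulSign_one_one,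
        zmod_two_one_add_one]
  · have h1 := Submodule.projection_apply_left (LieSuperalgebra.isCompl_part (𝔤 := 𝔤)).symm ⟨x, hx⟩
    have h2 := Submodule.projection_apply_right (LieSuperalgebra.isCompl_part (𝔤 := 𝔤)) ⟨x, hx⟩
    simp only at h1 h2
    simp [actRight, evenProj, oddProj, h1, h2, hp, koszulSign_comm 1 j, koszulSign_zero_left, koszulSign_zero_right, koszulSign_one_one,
        zmod_two_one_add_one, TensorProduct.smul_tmul']

/-- The grading of `V ⊗ W`: its part of degree `k` is spanned by the `v ⊗ w` with `v`, `w`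
homogeneous and `|v| + |w| = k`. -/
def tensorPart (ρ : SuperRep 𝔤 V) (σ : SuperRep 𝔤 W) (k : ZMod 2) : Submodule ℂ (V ⊗[ℂ] W) :=
  Submodule.span ℂ {t | ∃ i j : ZMod 2, i + j = k ∧
    ∃ v ∈ ρ.part i, ∃ w ∈ σ.part j, t = v ⊗ₜ[ℂ] w}

theorem tmul_mem_tensorPart (ρ : SuperRep 𝔤 V) (σ : SuperRep 𝔤 W) {i j k : ZMod 2} {v : V}
    {w : W} (hv : v ∈ ρ.part i) (hw : w ∈ σ.part j) (hk : i + j = k) :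
    v ⊗ₜ[ℂ] w ∈ ρ.tensorPart σ k :=
  Submodule.subset_span ⟨i, j, hk, v, hv, w, hw, rfl⟩

theorem parity_tensor (ρ : SuperRep 𝔤 V) (σ : SuperRep 𝔤 W) {k : ZMod 2} {t : V ⊗[ℂ] W}
    (ht : t ∈ ρ.tensorPart σ k) :
    TensorProduct.map ρ.parity σ.parity t = koszulSign k 1 • t := by
  induction ht using Submodule.span_induction with
  | mem t h =>
    obtain ⟨i, j, rfl, v, hv, w, hw, rfl⟩ := h
    rw [TensorProduct.map_tmul, ρ.parity_apply hv, σ.parity_apply hw, TensorProduct.smul_tmul_smul]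
    congr 1
    rcases zmod_two_cases i with rfl | rfl <;> rcases zmod_two_cases j with rfl | rfl <;>
      simp [koszulSign_zero_left, koszulSign_zero_right, koszulSign_one_one,
        zmod_two_one_add_one]
  | zero => simp
  | add a b _ _ ha hb => rw [map_add, ha, hb, smul_add]
  | smul c a _ ha => rw [map_smul, ha, smul_comm]

theorem tensor_ext (ρ : SuperRep 𝔤 V) (σ : SuperRep 𝔤 W) {f g : Module.End ℂ (V ⊗[ℂ] W)}
    (h : ∀ i, ∀ v ∈ ρ.part i, ∀ w : W, f (v ⊗ₜ w) = g (v ⊗ₜ w)) : f = g := by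
  refine TensorProduct.ext' fun v w => ?_
  obtain ⟨a, ha, b, hb, rfl⟩ := ρ.mem_decomp v
  rw [TensorProduct.add_tmul, map_add, map_add, h 0 a ha, h 1 b hb]

theorem isCompl_tensorPart (ρ : SuperRep 𝔤 V) (σ : SuperRep 𝔤 W) :
    IsCompl (ρ.tensorPart σ 0) (ρ.tensorPart σ 1) := by
  constructor
  · rw [Submodule.disjoint_def]
    intro t h0 h1
    have e := (ρ.parity_tensor σ h0).symm.trans (ρ.parity_tensor σ h1)
    rw [koszulSign_zero_left, koszulSign_one_one, one_smul, neg_one_smul] at e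
    have e2 : (2 : ℂ) • t = 0 := by rw [two_smul]; nth_rewrite 1 [e]; exact neg_add_cancel t
    exact (smul_eq_zero.1 e2).resolve_left two_ne_zero
  · rw [codisjoint_iff, eq_top_iff, ← TensorProduct.span_tmul_eq_top, Submodule.span_le]
    rintro _ ⟨v, w, rfl⟩
    obtain ⟨a, ha, b, hb, rfl⟩ := ρ.mem_decomp v
    obtain ⟨c, hc, d, hd, rfl⟩ := σ.mem_decomp w
    have e0 := Submodule.add_mem _ (ρ.tmul_mem_tensorPart σ ha hc (k := 0) rfl)
      (ρ.tmul_mem_tensorPart σ hb hd (k := 0) rfl)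
    have e1 := Submodule.add_mem _ (ρ.tmul_mem_tensorPart σ ha hd (k := 1) rfl)
      (ρ.tmul_mem_tensorPart σ hb hc (k := 1) rfl)
    have e := Submodule.add_mem_sup e0 e1
    have e' : (a + b) ⊗ₜ[ℂ] (c + d) =
        a ⊗ₜ c + b ⊗ₜ d + (a ⊗ₜ d + b ⊗ₜ c) := by
      simp only [TensorProduct.add_tmul, TensorProduct.tmul_add]
      abel
    rw [SetLike.mem_coe, e']
    exact e

/-- The tensor product of two representations; `x ∈ 𝔤` acts by `x ⊗ 1 + 1 ⊗ x`. -/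
def tensor (ρ : SuperRep 𝔤 V) (σ : SuperRep 𝔤 W) : SuperRep 𝔤 (V ⊗[ℂ] W) where
  part := ρ.tensorPart σ
  isCompl_part := ρ.isCompl_tensorPart σ
  act := ρ.actLeft σ + ρ.actRight σ
  act_mem := by
    intro i k x t hx ht
    induction ht using Submodule.span_induction with
    | mem t h =>
      obtain ⟨a, b, rfl, v, hv, w, hw, rfl⟩ := h
      rw [LinearMap.add_apply, LinearMap.add_apply, actLeft_tmul, actRight_tmul ρ σ hx hv]
      exact Submodule.add_mem _
        (ρ.tmul_mem_tensorPart σ (ρ.act_mem hx hv) hw (by ring))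
        (Submodule.smul_mem _ _ (ρ.tmul_mem_tensorPart σ hv (σ.act_mem hx hw) (by ring)))
    | zero => simp
    | add a b _ _ ha hb => rw [map_add]; exact Submodule.add_mem _ ha hb
    | smul c a _ ha => rw [map_smul]; exact Submodule.smul_mem _ _ ha
  act_bracket := by
    intro i j x y hx hy
    refine ρ.tensor_ext σ fun k v hv w => ?_
    simp only [LinearMap.add_apply, LinearMap.sub_apply, LinearMap.smul_apply, Module.End.mul_apply,
      actLeft_tmul, actRight_tmul ρ σ hx hv, actRight_tmul ρ σ hy hv,
      actRight_tmul ρ σ (bracket_mem hx hy) hv, map_add, map_smul,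
      actRight_tmul ρ σ hx (ρ.act_mem hy hv), actRight_tmul ρ σ hy (ρ.act_mem hx hv),
      ρ.act_bracket hx hy, σ.act_bracket hx hy, TensorProduct.sub_tmul, TensorProduct.tmul_sub,
      TensorProduct.tmul_smul, ← TensorProduct.smul_tmul']
    rcases zmod_two_cases i with rfl | rfl <;> rcases zmod_two_cases j with rfl | rfl <;>
      rcases zmod_two_cases k with rfl | rfl <;>
      simp only [add_zero, zero_add, koszulSign_zero_left, koszulSign_zero_right, koszulSign_one_one,
        zmod_two_one_add_one] <;> module

end SuperRep

/-! ### The Lie superalgebra `osp(1|2)` -/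

/-- Labels of the root vector basis `x_{-2α}, x_{-α}, h, x_α, x_{2α}`. -/
inductive OspIndex
  | m2 | m1 | zero | p1 | p2
  deriving DecidableEq

/-- The underlying space of `osp(1|2)`, in coordinates with respect to the root vector basis. -/
abbrev Osp12 : Type := OspIndex → ℂ

namespace Osp12

/-- The root vector `x_{-2α}`. -/
def xm2 : Osp12 := Pi.single .m2 1
/-- The root vector `x_{-α}`. -/
def xm1 : Osp12 := Pi.single .m1 1
/-- The Cartan element `h`. -/
def h : Osp12 := Pi.single .zero 1
/-- The root vector `x_{α}`. -/
def xp1 : Osp12 := Pi.single .p1 1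
/-- The root vector `x_{2α}`. -/
def xp2 : Osp12 := Pi.single .p2 1

/-- The parity of the basis vectors: `x_{±α}` are odd, the others are even. -/
def deg : OspIndex → ZMod 2
  | .m2 => 0
  | .m1 => 1
  | .zero => 0
  | .p1 => 1
  | .p2 => 0

/-- The even and odd parts of `osp(1|2)`. -/
def part (i : ZMod 2) : Submodule ℂ Osp12 where
  carrier := {x | ∀ k, deg k ≠ i → x k = 0}
  add_mem' := by
    intro a b ha hb k hk
    simp [ha k hk, hb k hk]
  zero_mem' := by simp
  smul_mem' := by
    intro c a ha k hk
    simp [ha k hk]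

/-- The bracket of `osp(1|2)`, in coordinates. -/
def bracket : Osp12 →ₗ[ℂ] Osp12 →ₗ[ℂ] Osp12 :=
  LinearMap.mk₂ ℂ (fun x y k => match k with
    | .m2 => 2 * (x .zero * y .m2 - x .m2 * y .zero) + 2 * (x .m1 * y .m1)
    | .m1 => (x .zero * y .m1 - x .m1 * y .zero) + (x .p1 * y .m2 - x .m2 * y .p1)
    | .zero => (x .m1 * y .p1 + x .p1 * y .m1) + (x .m2 * y .p2 - x .p2 * y .m2)
    | .p1 => -(x .zero * y .p1 - x .p1 * y .zero) + (x .m1 * y .p2 - x .p2 * y .m1)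
    | .p2 => -2 * (x .zero * y .p2 - x .p2 * y .zero) - 2 * (x .p1 * y .p1))
    (by intro a b c; ext k; cases k <;> simp <;> ring)
    (by intro a b c; ext k; cases k <;> simp <;> ring)
    (by intro a b c; ext k; cases k <;> simp <;> ring)
    (by intro a b c; ext k; cases k <;> simp <;> ring)

theorem mem_part_zero {x : Osp12} : x ∈ part 0 ↔ x .m1 = 0 ∧ x .p1 = 0 := by
  constructor
  · intro hx
    exact ⟨hx _ (by decide), hx _ (by decide)⟩
  · rintro ⟨h1, h2⟩ k hk
    cases k <;> first | assumption | exact absurd rfl hk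

theorem mem_part_one {x : Osp12} : x ∈ part 1 ↔ x .m2 = 0 ∧ x .zero = 0 ∧ x .p2 = 0 := by
  constructor
  · intro hx
    exact ⟨hx _ (by decide), hx _ (by decide), hx _ (by decide)⟩
  · rintro ⟨h1, h2, h3⟩ k hk
    cases k <;> first | assumption | exact absurd rfl hk

/-- The Lie superalgebra `osp(1|2)`. -/
instance instLieSuperalgebra : LieSuperalgebra Osp12 where
  part := part
  isCompl_part := by
    constructor
    · rw [Submodule.disjoint_def]
      intro x h0 h1
      rw [mem_part_zero] at h0
      rw [mem_part_one] at h1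
      ext k
      cases k <;> simp [h0, h1]
    · rw [codisjoint_iff, eq_top_iff]
      intro x _
      refine Submodule.mem_sup.2 ⟨fun k => if deg k = 0 then x k else 0, ?_,
        fun k => if deg k = 1 then x k else 0, ?_, ?_⟩
      · intro k hk; simp [hk]
      · intro k hk; simp [hk]
      · ext k; cases k <;> simp [deg]
  bracket := bracket
  bracket_mem := by
    intro i j x y hx hy
    rcases zmod_two_cases i with rfl | rfl <;> rcases zmod_two_cases j with rfl | rfl
    · have hx := mem_part_zero.1 hx
      have hy := mem_part_zero.1 hy
      refine mem_part_zero.2 ?_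
      simp [bracket, hx, hy]
    · have hx := mem_part_zero.1 hx
      have hy := mem_part_one.1 hy
      refine mem_part_one.2 ?_
      simp [bracket, hx, hy]
    · have hx := mem_part_one.1 hx
      have hy := mem_part_zero.1 hy
      refine mem_part_one.2 ?_
      simp [bracket, hx, hy]
    · have hx := mem_part_one.1 hx
      have hy := mem_part_one.1 hy
      refine mem_part_zero.2 ?_
      simp [bracket, hx, hy]
  bracket_skew := by
    intro i j x y hx hy
    rcases zmod_two_cases i with rfl | rfl <;> rcases zmod_two_cases j with rfl | rfl
    · have hx := mem_part_zero.1 hx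
      have hy := mem_part_zero.1 hy
      ext k; cases k <;> simp [bracket, hx, hy, koszulSign_zero_left, koszulSign_zero_right, koszulSign_one_one,
        zmod_two_one_add_one] <;> ring
    · have hx := mem_part_zero.1 hx
      have hy := mem_part_one.1 hy
      ext k; cases k <;> simp [bracket, hx, hy, koszulSign_zero_left, koszulSign_zero_right, koszulSign_one_one,
        zmod_two_one_add_one] <;> ring
    · have hx := mem_part_one.1 hx
      have hy := mem_part_zero.1 hy
      ext k; cases k <;> simp [bracket, hx, hy, koszulSign_zero_left, koszulSign_zero_right, koszulSign_one_one,
        zmod_two_one_add_one] <;> ring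
    · have hx := mem_part_one.1 hx
      have hy := mem_part_one.1 hy
      ext k; cases k <;> simp [bracket, hx, hy, koszulSign_zero_left, koszulSign_zero_right, koszulSign_one_one,
        zmod_two_one_add_one] <;> ring
  jacobi := by
    intro i j x y z hx hy
    rcases zmod_two_cases i with rfl | rfl <;> rcases zmod_two_cases j with rfl | rfl
    · have hx := mem_part_zero.1 hx
      have hy := mem_part_zero.1 hy
      ext k; cases k <;> simp [bracket, hx, hy, koszulSign_zero_left, koszulSign_zero_right, koszulSign_one_one,
        zmod_two_one_add_one] <;> ring
    · have hx := mem_part_zero.1 hx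
      have hy := mem_part_one.1 hy
      ext k; cases k <;> simp [bracket, hx, hy, koszulSign_zero_left, koszulSign_zero_right, koszulSign_one_one,
        zmod_two_one_add_one] <;> ring
    · have hx := mem_part_one.1 hx
      have hy := mem_part_zero.1 hy
      ext k; cases k <;> simp [bracket, hx, hy, koszulSign_zero_left, koszulSign_zero_right, koszulSign_one_one,
        zmod_two_one_add_one] <;> ring
    · have hx := mem_part_one.1 hx
      have hy := mem_part_one.1 hy
      ext k; cases k <;> simp [bracket, hx, hy, koszulSign_zero_left, koszulSign_zero_right, koszulSign_one_one,
        zmod_two_one_add_one] <;> ring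

/-- The defining relations of `osp(1|2)` between the root vectors. -/
theorem relations :
    (bracket h xm2 = (2 : ℂ) • xm2 ∧ bracket h xm1 = xm1 ∧ bracket h xp1 = -xp1 ∧
      bracket h xp2 = -((2 : ℂ) • xp2)) ∧
    (bracket xm1 xp1 = h ∧ bracket xm2 xp2 = h) ∧
    (bracket xp1 xp1 = -((2 : ℂ) • xp2) ∧ bracket xm1 xm1 = (2 : ℂ) • xm2) ∧
    (bracket xp1 xm2 = xm1 ∧ bracket xm1 xp2 = xp1) ∧
    (bracket xp2 xp1 = 0 ∧ bracket xm2 xm1 = 0) := by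
  refine ⟨⟨?_, ?_, ?_, ?_⟩, ⟨?_, ?_⟩, ⟨?_, ?_⟩, ⟨?_, ?_⟩, ⟨?_, ?_⟩⟩ <;> ext k <;> cases k <;>
    simp [bracket, h, xm1, xm2, xp1, xp2]

/-- `U(𝔫₋)`, as the subalgebra of `U(osp(1|2))` generated by `𝔫₋ = ℂ x_{-2α} ⊕ ℂ x_{-α}`. -/
def envNMinus : Subalgebra ℂ (Env Osp12) :=
  Algebra.adjoin ℂ (Env.ι Osp12 '' (Submodule.span ℂ {xm2, xm1} : Submodule ℂ Osp12))

variable {V : Type*} [AddCommGroup V] [Module ℂ V]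
variable {W : Type*} [AddCommGroup W] [Module ℂ W]

/-- Primitive vectors: those annihilated by `𝔫₊ = ℂ x_{α} ⊕ ℂ x_{2α}`. -/
def IsPrimitive (ρ : SuperRep Osp12 V) (v : V) : Prop :=
  ρ.act xp1 v = 0 ∧ ρ.act xp2 v = 0

/-- Highest weight vectors of weight `ξ`: nonzero primitive vectors `v` with `h v = ξ v`. -/
def IsHighestWeightVector (ρ : SuperRep Osp12 V) (ξ : ℂ) (v : V) : Prop :=
  v ≠ 0 ∧ ρ.act h v = ξ • v ∧ IsPrimitive ρ v

/-- `X = x ⊗ 1 + 1 ⊗ x` as an operator on `V ⊗ W`. -/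
def diag (ρ : SuperRep Osp12 V) (σ : SuperRep Osp12 W) (x : Osp12) : Module.End ℂ (V ⊗[ℂ] W) :=
  ρ.actLeft σ x + ρ.actRight σ x

/-- `x̃ = x ⊗ 1 - 1 ⊗ x` as an operator on `V ⊗ W`. -/
def antidiag (ρ : SuperRep Osp12 V) (σ : SuperRep Osp12 W) (x : Osp12) :
    Module.End ℂ (V ⊗[ℂ] W) :=
  ρ.actLeft σ x - ρ.actRight σ x

/-- The lowering operator
`x̃_{-α} - (H-1)⁻¹ X_{-α} h̃ - (H-1)⁻¹ X_{-α}² x̃_α - 2 ((H-2)(H-1))⁻¹ X_{-α}³ x̃_{2α}`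
on `V ⊗ W`; it is meaningful when `H - 1` and `H - 2` are invertible on `V ⊗ W`. -/
def lowering (ρ : SuperRep Osp12 V) (σ : SuperRep Osp12 W) : Module.End ℂ (V ⊗[ℂ] W) :=
  antidiag ρ σ xm1
    - Ring.inverse (diag ρ σ h - 1) * diag ρ σ xm1 * antidiag ρ σ h
    - Ring.inverse (diag ρ σ h - 1) * diag ρ σ xm1 ^ 2 * antidiag ρ σ xp1
    - (2 : ℂ) • (Ring.inverse ((diag ρ σ h - 2) * (diag ρ σ h - 1)) * diag ρ σ xm1 ^ 3
        * antidiag ρ σ xp2)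

/-- Even (`i = 0`) and odd (`i = 1`) polynomials. -/
def polyPart (i : ZMod 2) : Submodule ℂ ℂ[X] where
  carrier := {p | ∀ n : ℕ, (n : ZMod 2) ≠ i → p.coeff n = 0}
  add_mem' := by
    intro a b ha hb k hk
    simp [ha k hk, hb k hk]
  zero_mem' := by simp
  smul_mem' := by
    intro c a ha k hk
    simp [ha k hk]

/-- The operators on `ℂ[x]` by which the root vectors act: `x_{-α} = x / 2`, `x_α = d/dx`,
`x_{-2α} = x² / 4`, `x_{2α} = - d²/dx²`, `h = x d/dx + 1/2`. -/
def polyOp : OspIndex → Module.End ℂ ℂ[X]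
  | .m2 => (1 / 4 : ℂ) • LinearMap.mulLeft ℂ (X ^ 2 : ℂ[X])
  | .m1 => (1 / 2 : ℂ) • LinearMap.mulLeft ℂ (X : ℂ[X])
  | .zero => LinearMap.mulLeft ℂ (X : ℂ[X]) * derivative + (1 / 2 : ℂ) • 1
  | .p1 => derivative
  | .p2 => -(derivative * derivative)

/-- The action of `osp(1|2)` on `ℂ[x]`. -/
def polyAct : Osp12 →ₗ[ℂ] Module.End ℂ ℂ[X] where
  toFun x := x .m2 • polyOp .m2 + x .m1 • polyOp .m1 + x .zero • polyOp .zero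
    + x .p1 • polyOp .p1 + x .p2 • polyOp .p2
  map_add' := by intro x y; simp only [Pi.add_apply]; module
  map_smul' := by intro c x; simp only [Pi.smul_apply, RingHom.id_apply, smul_eq_mul]; module

theorem mem_polyPart_X_mul {i : ZMod 2} {p : ℂ[X]} (hp : p ∈ polyPart i) :
    X * p ∈ polyPart (1 + i) := by
  rintro (_ | n) hn
  · simp
  · rw [coeff_X_mul]
    refine hp n fun h => hn ?_
    rw [← h]; push_cast; ring

theorem mem_polyPart_derivative {i : ZMod 2} {p : ℂ[X]} (hp : p ∈ polyPart i) :
    derivative p ∈ polyPart (1 + i) := by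
  intro n hn
  rw [coeff_derivative, hp (n + 1) (fun h => hn ?_), zero_mul]
  rw [← h]; push_cast
  linear_combination (-1 : ZMod 2) * zmod_two_one_add_one

theorem polyAct_apply (x : Osp12) (p : ℂ[X]) :
    polyAct x p = (x .m2 * (1 / 4)) • (X * (X * p)) + (x .m1 * (1 / 2)) • (X * p)
      + (x .zero • (X * derivative p) + (x .zero * (1 / 2)) • p)
      + x .p1 • derivative p + (-x .p2) • derivative (derivative p) := by
  simp only [polyAct, polyOp, LinearMap.coe_mk, AddHom.coe_mk, LinearMap.add_apply,
    LinearMap.smul_apply, LinearMap.mulLeft_apply, Module.End.mul_apply,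
    LinearMap.neg_apply, Module.End.one_apply, pow_two, mul_assoc]
  module

theorem polyAct_mem {i j : ZMod 2} {x : Osp12} {p : ℂ[X]} (hx : x ∈ part i)
    (hp : p ∈ polyPart j) : polyAct x p ∈ polyPart (i + j) := by
  have hX := mem_polyPart_X_mul hp
  have hD := mem_polyPart_derivative hp
  rw [polyAct_apply]
  rcases zmod_two_cases i with rfl | rfl
  · have hx := mem_part_zero.1 hx
    have e : (1 : ZMod 2) + (1 + j) = 0 + j := by
      rw [← add_assoc, zmod_two_one_add_one]
    have hXX := mem_polyPart_X_mul hX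
    have hXD := mem_polyPart_X_mul hD
    have hDD := mem_polyPart_derivative hD
    rw [e] at hXX hXD hDD
    rw [← zero_add j] at hp
    rw [hx.1, hx.2, zero_mul, zero_smul, zero_smul, add_zero, add_zero]
    exact Submodule.add_mem _ (Submodule.add_mem _ (Submodule.smul_mem _ _ hXX)
      (Submodule.add_mem _ (Submodule.smul_mem _ _ hXD) (Submodule.smul_mem _ _ hp)))
      (Submodule.smul_mem _ _ hDD)
  · have hx := mem_part_one.1 hx
    rw [hx.1, hx.2.1, hx.2.2, zero_mul, zero_mul, neg_zero, zero_smul, zero_smul, zero_smul,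
      zero_smul, zero_add, add_zero, add_zero, add_zero]
    exact Submodule.add_mem _ (Submodule.smul_mem _ _ hX) (Submodule.smul_mem _ _ hD)

theorem polyAct_bracket {i j : ZMod 2} {x y : Osp12} (hx : x ∈ part i) (hy : y ∈ part j)
    (p : ℂ[X]) :
    polyAct (bracket x y) p =
      polyAct x (polyAct y p) - koszulSign i j • polyAct y (polyAct x p) := by
  have dX : ∀ q : ℂ[X], derivative (X * q) = q + X * derivative q := fun q => by
    rw [derivative_mul, derivative_X, one_mul]
  rcases zmod_two_cases i with rfl | rfl <;> rcases zmod_two_cases j with rfl | rfl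
  · have hx := mem_part_zero.1 hx
    have hy := mem_part_zero.1 hy
    simp only [polyAct_apply, bracket, LinearMap.mk₂_apply, hx, hy, koszulSign_zero_left,
      koszulSign_zero_right, koszulSign_one_one, dX, derivative_smul,
      map_add, mul_add, mul_smul_comm, zero_mul, mul_zero, zero_smul, smul_zero, neg_zero, add_zero, zero_add, sub_zero]
    module
  · have hx := mem_part_zero.1 hx
    have hy := mem_part_one.1 hy
    simp only [polyAct_apply, bracket, LinearMap.mk₂_apply, hx, hy, koszulSign_zero_left,
      koszulSign_zero_right, koszulSign_one_one, dX, derivative_smul,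
      map_add, mul_add, mul_smul_comm, zero_mul, mul_zero, zero_smul, smul_zero, neg_zero, add_zero, zero_add, sub_zero]
    module
  · have hx := mem_part_one.1 hx
    have hy := mem_part_zero.1 hy
    simp only [polyAct_apply, bracket, LinearMap.mk₂_apply, hx, hy, koszulSign_zero_left,
      koszulSign_zero_right, koszulSign_one_one, dX, derivative_smul,
      map_add, mul_add, mul_smul_comm, zero_mul, mul_zero, zero_smul, smul_zero, neg_zero, add_zero, zero_add, sub_zero]
    module
  · have hx := mem_part_one.1 hx
    have hy := mem_part_one.1 hy
    simp only [polyAct_apply, bracket, LinearMap.mk₂_apply, hx, hy, koszulSign_zero_left,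
      koszulSign_zero_right, koszulSign_one_one, dX, derivative_smul,
      map_add, mul_add, mul_smul_comm, zero_mul, mul_zero, zero_smul, smul_zero, neg_zero, add_zero, zero_add, sub_zero]
    module

/-- The polynomial representation `ℂ[x] = V(1/2)` of `osp(1|2)`. -/
def polyRep : SuperRep Osp12 ℂ[X] where
  part := polyPart
  isCompl_part := by
    constructor
    · rw [Submodule.disjoint_def]
      intro p h0 h1
      ext n
      rcases zmod_two_cases n with h | h
      · exact h1 n (by rw [h]; decide)
      · exact h0 n (by rw [h]; decide)
    · rw [codisjoint_iff, eq_top_iff]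
      intro p _
      induction p using Polynomial.induction_on' with
      | add p q hp hq => exact Submodule.add_mem _ (hp trivial) (hq trivial)
      | monomial n a =>
        have key : ∀ i : ZMod 2, (n : ZMod 2) = i → monomial n a ∈ polyPart i := by
          intro i hi m hm
          rw [coeff_monomial, if_neg]
          rintro rfl
          exact hm hi
        rcases zmod_two_cases n with h | h
        · exact Submodule.mem_sup_left (key _ h)
        · exact Submodule.mem_sup_right (key _ h)
  act := polyAct
  act_mem hx hp := polyAct_mem hx hp
  act_bracket hx hy := LinearMap.ext fun p => polyAct_bracket hx hy p

theorem isHighestWeightVector_polyRep_one : IsHighestWeightVector polyRep (1 / 2) (1 : ℂ[X]) := by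
  refine ⟨one_ne_zero, ?_, ?_, ?_⟩ <;> change polyAct _ _ = _ <;>
    simp [polyAct_apply, h, xp1, xp2]

end Osp12

end

namespace Osp12

open LieSuperalgebra

variable {M : Type*} [AddCommGroup M] [Module ℂ M]

/-! Write E, F for the actions of `xp1`, `xm1`. These two odd elements generate osp(1|2): EF + FE =
h, x_{-2α} acts as F² and x_{2α} as -E². Hence a vector is primitive iff E kills it, and U(n₋)w is
the span of the F^k w. Note that F raises the h-eigenvalue by 1.

For a primitive w of weight μ, E F^k w = a_k F^{k-1} w with a_{2m} = m and a_{2m+1} = μ + m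
(`act_xp1_pow`, `raiseCoeff_two_mul`). If μ is none of 0, -1, -2, ..., all a_k with k ≥ 1 are
nonzero; then on U(n₋)w the map E is onto and its kernel is the line through w. If E is moreover
locally nilpotent on the ambient module, such a U(n₋)w is irreducible, and the whole module is the
direct sum of the U(n₋)w_j as soon as the w_j form a basis of ker E
(`isIrreducibleSubrep_cyclicSpan`, `isInternal_cyclicSpan`).

It remains to see that the T^j(1 ⊗ v), 0 ≤ j ≤ 2ℓ, form a basis of ker E on ℂ[x] ⊗ V. An element of
this kernel is determined by its constant coefficient in V (`eq_zero_of_tensorCoeff_zero`), because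
E differentiates the first factor. T maps primitive weight vectors to primitive vectors of weight
one higher (`diag_h_lowering`, `diag_xp1_lowering`), and on constant coefficients it sends F^j v to
a nonzero multiple of F^{j+1} v (`tensorCoeff_zero_lowering`, `lowering_scalar_ne_zero`). The F^j v
with j ≤ 2ℓ form a basis of V (`exists_basis_pow`). All weights of ℂ[x] ⊗ V lie in 1/2 + ℤ, so no
denominator and no relevant a_k vanishes. -/

theorem xm1_mem_part : xm1 ∈ LieSuperalgebra.part (𝔤 := Osp12) 1 :=
  mem_part_one.2 (by simp [xm1])

theorem h_mem_part : h ∈ LieSuperalgebra.part (𝔤 := Osp12) 0 :=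
  mem_part_zero.2 (by simp [h])

theorem xp1_mem_part : xp1 ∈ LieSuperalgebra.part (𝔤 := Osp12) 1 :=
  mem_part_one.2 (by simp [xp1])

theorem xp2_mem_part : xp2 ∈ LieSuperalgebra.part (𝔤 := Osp12) 0 :=
  mem_part_zero.2 (by simp [xp2])

theorem eq_sum_rootVectors (x : Osp12) :
    x = x .m2 • xm2 + x .m1 • xm1 + x .zero • h + x .p1 • xp1 + x .p2 • xp2 := by
  ext k; cases k <;> simp [xm2, xm1, h, xp1, xp2]

/-! ### Operator identities in a representation -/

section Relations

variable (σ : SuperRep Osp12 M)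

theorem act_xp1_xm1 (u : M) :
    σ.act xp1 (σ.act xm1 u) = σ.act h u - σ.act xm1 (σ.act xp1 u) := by
  have e := σ.act_bracket xm1_mem_part xp1_mem_part
  rw [show LieSuperalgebra.bracket xm1 xp1 = h from relations.2.1.1, koszulSign_one_one] at e
  rw [e]; simp

theorem act_h_xm1 (u : M) : σ.act h (σ.act xm1 u) = σ.act xm1 (σ.act h u) + σ.act xm1 u := by
  have e := σ.act_bracket h_mem_part xm1_mem_part
  rw [show LieSuperalgebra.bracket h xm1 = xm1 from relations.1.2.1, koszulSign_zero_left] at e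
  conv_rhs => arg 2; rw [e]
  simp

theorem act_xm2 (u : M) : σ.act xm2 u = σ.act xm1 (σ.act xm1 u) := by
  have e := congr($(σ.act_bracket xm1_mem_part xm1_mem_part) u)
  rw [show LieSuperalgebra.bracket xm1 xm1 = (2 : ℂ) • xm2 from relations.2.2.1.2,
    koszulSign_one_one] at e
  simp only [map_smul, LinearMap.smul_apply, Module.End.mul_apply,
    neg_smul, one_smul, sub_neg_eq_add, ← two_smul ℂ] at e
  exact smul_right_injective M (two_ne_zero (α := ℂ)) e

theorem act_xp2 (u : M) : σ.act xp2 u = -σ.act xp1 (σ.act xp1 u) := by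
  have e := congr($(σ.act_bracket xp1_mem_part xp1_mem_part) u)
  rw [show LieSuperalgebra.bracket xp1 xp1 = -((2 : ℂ) • xp2) from relations.2.2.1.1,
    koszulSign_one_one] at e
  simp only [map_smul, map_neg, LinearMap.neg_apply, LinearMap.smul_apply,
    Module.End.mul_apply, neg_smul, one_smul, sub_neg_eq_add, ← two_smul ℂ] at e
  rw [← smul_neg] at e
  rw [← smul_right_injective M (two_ne_zero (α := ℂ)) e, neg_neg]

theorem isPrimitive_iff (u : M) : IsPrimitive σ u ↔ σ.act xp1 u = 0 :=
  ⟨fun hu => hu.1, fun hu => ⟨hu, by rw [act_xp2, hu, map_zero, neg_zero]⟩⟩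

/-- `xm1` and `xp1` generate: h = EF + FE, and x_{±2α} act as squares up to sign. -/
theorem act_mem_of_stable {N : Submodule ℂ M} (hm : ∀ u ∈ N, σ.act xm1 u ∈ N)
    (hp : ∀ u ∈ N, σ.act xp1 u ∈ N) (x : Osp12) (u : M) (hu : u ∈ N) : σ.act x u ∈ N := by
  have hh : σ.act h u ∈ N := by
    have e := act_xp1_xm1 σ u
    rw [eq_sub_iff_add_eq] at e
    rw [← e]
    exact N.add_mem (hp _ (hm _ hu)) (hm _ (hp _ hu))
  rw [eq_sum_rootVectors x]
  simp only [map_add, map_smul, LinearMap.add_apply, LinearMap.smul_apply, act_xm2, act_xp2]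
  refine N.add_mem (N.add_mem (N.add_mem (N.add_mem ?_ ?_) ?_) ?_) ?_ <;>
    apply N.smul_mem
  exacts [hm _ (hm _ hu), hm _ hu, hh, hp _ hu, N.neg_mem (hp _ (hp _ hu))]

end Relations

/-! ### Highest weight modules -/

/-- The scalars `a_k` in `x_α x_{-α}^k w = a_k x_{-α}^{k-1} w`, for a primitive vector `w` of
weight `μ`. -/
noncomputable def raiseCoeff (μ : ℂ) : ℕ → ℂ
  | 0 => 0
  | k + 1 => μ + k - raiseCoeff μ k

/-- Two steps of the recursion cancel μ: a_{k+2} = a_k + 1. So the even and odd subsequences are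
arithmetic, starting at 0 and μ. -/
theorem raiseCoeff_two_mul (μ : ℂ) (m : ℕ) :
    raiseCoeff μ (2 * m) = m ∧ raiseCoeff μ (2 * m + 1) = μ + m := by
  induction m with
  | zero => simp [raiseCoeff]
  | succ m ih =>
    have e : raiseCoeff μ (2 * (m + 1)) = ((m + 1 : ℕ) : ℂ) := by
      rw [show 2 * (m + 1) = (2 * m + 1) + 1 by ring, raiseCoeff, ih.2]
      push_cast; ring
    refine ⟨e, ?_⟩
    rw [raiseCoeff, e]
    push_cast; ring

theorem raiseCoeff_ne_zero {μ : ℂ} (hμ : ∀ m : ℕ, μ + m ≠ 0) (k : ℕ) :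
    raiseCoeff μ (k + 1) ≠ 0 := by
  obtain ⟨m, hm | hm⟩ := Nat.even_or_odd' (k + 1)
  · rw [hm, (raiseCoeff_two_mul μ m).1]
    exact Nat.cast_ne_zero.2 (by omega)
  · rw [hm, (raiseCoeff_two_mul μ m).2]
    exact hμ m

/-- The span of the vectors `x_{-α}^k w`. -/
def cyclicSpan (σ : SuperRep Osp12 M) (w : M) : Submodule ℂ M :=
  Submodule.span ℂ (Set.range fun k : ℕ => (σ.act xm1 ^ k) w)

section CyclicSpan

variable (σ : SuperRep Osp12 M) {w : M} {μ : ℂ}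

theorem pow_mem_cyclicSpan (w : M) (k : ℕ) : (σ.act xm1 ^ k) w ∈ cyclicSpan σ w :=
  Submodule.subset_span ⟨k, rfl⟩

theorem self_mem_cyclicSpan (w : M) : w ∈ cyclicSpan σ w := pow_mem_cyclicSpan σ w 0

theorem act_xm1_mem_cyclicSpan (w : M) : ∀ u ∈ cyclicSpan σ w, σ.act xm1 u ∈ cyclicSpan σ w := by
  intro u hu
  induction hu using Submodule.span_induction with
  | mem u h =>
    obtain ⟨k, rfl⟩ := h
    rw [← Module.End.mul_apply, ← pow_succ']
    exact pow_mem_cyclicSpan σ w _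
  | zero => simp
  | add a b _ _ ha hb => rw [map_add]; exact Submodule.add_mem _ ha hb
  | smul c a _ ha => rw [map_smul]; exact Submodule.smul_mem _ _ ha

theorem cyclicSpan_le {N : Submodule ℂ M} (hN : ∀ u ∈ N, σ.act xm1 u ∈ N) (hw : w ∈ N) :
    cyclicSpan σ w ≤ N := by
  refine Submodule.span_le.2 ?_
  rintro _ ⟨k, rfl⟩
  induction k with
  | zero => simpa using hw
  | succ k ih =>
    simp only [pow_succ', Module.End.mul_apply]
    exact hN _ ih

theorem orbit_envNMinus_eq_cyclicSpan (w : M) : σ.orbit envNMinus w = cyclicSpan σ w := by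
  have hι : ∀ x, σ.envAct (Env.ι Osp12 x) = σ.act x := fun x => by
    simp [SuperRep.envAct, Env.ι]
  apply le_antisymm
  · rintro _ ⟨u, hu, rfl⟩
    change σ.envAct u w ∈ _
    -- The claim is needed on the whole span, not only at w, for the induction to pass through
    -- products.
    have key : ∀ y ∈ cyclicSpan σ w, σ.envAct u y ∈ cyclicSpan σ w := by
      have hu' : u ∈ envNMinus := hu
      rw [envNMinus] at hu'
      clear hu
      induction hu' using Algebra.adjoin_induction with
      | mem u hu =>
        obtain ⟨x, hx, rfl⟩ := hu
        intro y hy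
        rw [hι]
        obtain ⟨a, b, rfl⟩ := Submodule.mem_span_pair.1 hx
        simp only [map_add, map_smul, LinearMap.add_apply, LinearMap.smul_apply, act_xm2]
        have h1 := act_xm1_mem_cyclicSpan σ w y hy
        exact Submodule.add_mem _ (Submodule.smul_mem _ _ (act_xm1_mem_cyclicSpan σ w _ h1))
          (Submodule.smul_mem _ _ h1)
      | algebraMap r =>
        intro y hy
        rw [AlgHom.commutes, Module.algebraMap_end_apply]
        exact Submodule.smul_mem _ _ hy
      | add a b _ _ ha hb =>
        intro y hy
        rw [map_add]
        exact Submodule.add_mem _ (ha y hy) (hb y hy)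
      | mul a b _ _ ha hb =>
        intro y hy
        rw [map_mul]
        exact ha _ (hb y hy)
    exact key w (self_mem_cyclicSpan σ w)
  · refine Submodule.span_le.2 ?_
    rintro _ ⟨k, rfl⟩
    refine ⟨Env.ι Osp12 xm1 ^ k, ?_, ?_⟩
    · have hmem : Env.ι Osp12 xm1 ∈ envNMinus :=
        Algebra.subset_adjoin (Set.mem_image_of_mem _ (Submodule.subset_span (by simp)))
      exact pow_mem hmem k
    · change σ.envAct (Env.ι Osp12 xm1 ^ k) w = _
      rw [map_pow, hι]

theorem act_h_pow (hw : σ.act h w = μ • w) (k : ℕ) :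
    σ.act h ((σ.act xm1 ^ k) w) = (μ + k) • (σ.act xm1 ^ k) w := by
  induction k with
  | zero => simpa using hw
  | succ k ih =>
    rw [pow_succ', Module.End.mul_apply, act_h_xm1, ih, map_smul]
    push_cast; module

/-- EF = h - FE and F^k w has weight μ + k, which gives exactly the recursion a_{k+1} = μ + k - a_k.
-/
theorem act_xp1_pow (hw : σ.act h w = μ • w) (he : σ.act xp1 w = 0) (k : ℕ) :
    σ.act xp1 ((σ.act xm1 ^ (k + 1)) w) = raiseCoeff μ (k + 1) • (σ.act xm1 ^ k) w := by
  induction k with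
  | zero => simp [act_xp1_xm1, hw, he, raiseCoeff]
  | succ k ih =>
    rw [pow_succ', Module.End.mul_apply, act_xp1_xm1, ih, act_h_pow σ hw, map_smul,
      ← Module.End.mul_apply, ← pow_succ', raiseCoeff.eq_2 μ (k + 1)]
    module

theorem act_xp1_mem_cyclicSpan (hw : σ.act h w = μ • w) (he : σ.act xp1 w = 0) :
    ∀ u ∈ cyclicSpan σ w, σ.act xp1 u ∈ cyclicSpan σ w := by
  intro u hu
  induction hu using Submodule.span_induction with
  | mem u h =>
    obtain ⟨_ | k, rfl⟩ := h
    · simp [he]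
    · simp only [act_xp1_pow σ hw he]
      exact Submodule.smul_mem _ _ (pow_mem_cyclicSpan σ w _)
  | zero => simp
  | add a b _ _ ha hb => rw [map_add]; exact Submodule.add_mem _ ha hb
  | smul c a _ ha => rw [map_smul]; exact Submodule.smul_mem _ _ ha

theorem pow_mem_part {i : ZMod 2} (hi : w ∈ σ.part i) (k : ℕ) :
    ∃ j, (σ.act xm1 ^ k) w ∈ σ.part j := by
  induction k with
  | zero => exact ⟨i, by simpa using hi⟩
  | succ k ih =>
    obtain ⟨j, hj⟩ := ih
    exact ⟨1 + j, by rw [pow_succ', Module.End.mul_apply]; exact σ.act_mem xm1_mem_part hj⟩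

theorem isSubrep_cyclicSpan {i : ZMod 2} (hi : w ∈ σ.part i) (hw : σ.act h w = μ • w)
    (he : σ.act xp1 w = 0) : σ.IsSubrep (cyclicSpan σ w) := by
  refine ⟨Submodule.span_le.2 ?_, act_mem_of_stable σ (act_xm1_mem_cyclicSpan σ w)
    (act_xp1_mem_cyclicSpan σ hw he)⟩
  rintro _ ⟨k, rfl⟩
  obtain ⟨j, hj⟩ := pow_mem_part σ hi k
  rcases zmod_two_cases j with rfl | rfl
  · exact Submodule.mem_sup_left ⟨pow_mem_cyclicSpan σ w k, hj⟩
  · exact Submodule.mem_sup_right ⟨pow_mem_cyclicSpan σ w k, hj⟩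

theorem pow_ne_zero_of_weight (hw0 : w ≠ 0) (hw : σ.act h w = μ • w) (he : σ.act xp1 w = 0)
    (hμ : ∀ m : ℕ, μ + m ≠ 0) (k : ℕ) : (σ.act xm1 ^ k) w ≠ 0 := by
  induction k with
  | zero => simpa using hw0
  | succ k ih =>
    intro h0
    have e := act_xp1_pow σ hw he k
    rw [h0, map_zero] at e
    exact smul_ne_zero (raiseCoeff_ne_zero hμ k) ih e.symm

/-- Eigenvectors of h for the distinct weights μ + k. The index set is free so as to cover both
infinite strings and initial segments. -/
theorem linearIndependent_pow {s : Set ℕ} (hw : σ.act h w = μ • w)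
    (h0 : ∀ k ∈ s, (σ.act xm1 ^ k) w ≠ 0) :
    LinearIndependent ℂ fun k : s => (σ.act xm1 ^ (k : ℕ)) w := by
  refine Module.End.eigenvectors_linearIndependent' (σ.act h) (fun k : s => μ + (k : ℕ)) ?_ _
    fun k => ⟨Module.End.mem_eigenspace_iff.2 (act_h_pow σ hw k), h0 k k.2⟩
  intro a b hab
  simpa [Subtype.ext_iff] using hab

/-- E shifts the basis F^k w down by one with nonzero factors, so a combination killed by E has no
term with k ≥ 1. -/
theorem mem_span_of_mem_cyclicSpan (hw0 : w ≠ 0) (hw : σ.act h w = μ • w)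
    (he : σ.act xp1 w = 0) (hμ : ∀ m : ℕ, μ + m ≠ 0) {u : M} (hu : u ∈ cyclicSpan σ w)
    (heu : σ.act xp1 u = 0) : ∃ c : ℂ, u = c • w := by
  have hli : LinearIndependent ℂ fun k : ℕ => (σ.act xm1 ^ k) w := by
    have := linearIndependent_pow σ (s := Set.univ) hw
      fun k _ => pow_ne_zero_of_weight σ hw0 hw he hμ k
    exact this.comp (fun k : ℕ => ⟨k, trivial⟩) fun a b hab => congr_arg Subtype.val hab
  obtain ⟨c, rfl⟩ := Finsupp.mem_span_range_iff_exists_finsupp.1 hu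
  have key : ∀ k, c (k + 1) = 0 := by
    -- The truncation 0 - 1 = 0 is harmless: the term k = 0 carries the factor a_0 = 0.
    have e : (Finsupp.linearCombination ℂ fun k : ℕ => (σ.act xm1 ^ k) w)
        (c.sum fun k a => Finsupp.single (k - 1) (a * raiseCoeff μ k)) = 0 := by
      rw [← heu, map_finsuppSum, map_finsuppSum]
      refine Finsupp.sum_congr fun k _ => ?_
      rw [Finsupp.linearCombination_single, map_smul]
      rcases k with _ | k
      · simp [he, raiseCoeff]
      · rw [act_xp1_pow σ hw he, mul_smul, Nat.add_sub_cancel]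
    have e0 := (linearIndependent_iff.1 hli) _ e
    intro k
    have e1 := congr($e0 k)
    rw [Finsupp.sum_apply, Finsupp.sum, Finsupp.zero_apply] at e1
    by_contra hne
    rw [Finset.sum_eq_single (k + 1)] at e1
    · simp only [Nat.add_sub_cancel, Finsupp.single_eq_same] at e1
      exact mul_ne_zero hne (raiseCoeff_ne_zero hμ k) e1
    · intro b _ hb
      rcases b with _ | b
      · simp [raiseCoeff]
      · rw [Finsupp.single_apply, if_neg]
        omega
    · intro hk
      exact absurd (Finsupp.notMem_support_iff.1 hk) hne
  refine ⟨c 0, ?_⟩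
  have hc : c = Finsupp.single 0 (c 0) := by
    ext k
    rcases k with _ | k
    · simp
    · simp [key k]
  rw [hc]
  simp

theorem exists_act_xp1_eq (hw : σ.act h w = μ • w) (he : σ.act xp1 w = 0)
    (hμ : ∀ m : ℕ, μ + m ≠ 0) {u : M} (hu : u ∈ cyclicSpan σ w) :
    ∃ y ∈ cyclicSpan σ w, σ.act xp1 y = u := by
  induction hu using Submodule.span_induction with
  | mem u h =>
    obtain ⟨k, rfl⟩ := h
    refine ⟨(raiseCoeff μ (k + 1))⁻¹ • (σ.act xm1 ^ (k + 1)) w,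
      Submodule.smul_mem _ _ (pow_mem_cyclicSpan σ w _), ?_⟩
    rw [map_smul, act_xp1_pow σ hw he, inv_smul_smul₀ (raiseCoeff_ne_zero hμ k)]
  | zero => exact ⟨0, Submodule.zero_mem _, map_zero _⟩
  | add a b _ _ ha hb =>
    obtain ⟨y, hy, rfl⟩ := ha
    obtain ⟨z, hz, rfl⟩ := hb
    exact ⟨y + z, Submodule.add_mem _ hy hz, map_add _ _ _⟩
  | smul c a _ ha =>
    obtain ⟨y, hy, rfl⟩ := ha
    exact ⟨c • y, Submodule.smul_mem _ _ hy, map_smul _ _ _⟩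

theorem isIrreducibleSubrep_cyclicSpan (hnil : ∀ u : M, ∃ n : ℕ, (σ.act xp1 ^ n) u = 0)
    {i : ZMod 2} (hi : w ∈ σ.part i) (hw0 : w ≠ 0) (hw : σ.act h w = μ • w)
    (he : σ.act xp1 w = 0) (hμ : ∀ m : ℕ, μ + m ≠ 0) :
    σ.IsIrreducibleSubrep (cyclicSpan σ w) := by
  refine ⟨isSubrep_cyclicSpan σ hi hw he, ?_, ?_⟩
  · intro hbot
    exact hw0 ((Submodule.mem_bot ℂ).1 (hbot ▸ self_mem_cyclicSpan σ w))
  · intro N hN hle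
    by_cases hb : N = ⊥
    · exact Or.inl hb
    refine Or.inr (le_antisymm hle (cyclicSpan_le σ (hN.2 xm1) ?_))
    obtain ⟨u, huN, hu0⟩ := N.exists_mem_ne_zero_of_ne_bot hb
    classical
    have hmem : ∀ n, (σ.act xp1 ^ n) u ∈ N := by
      intro n
      induction n with
      | zero => simpa using huN
      | succ n ih => rw [pow_succ', Module.End.mul_apply]; exact hN.2 _ _ ih
    -- With n + 1 the least power of E killing u, the vector E^n u of N is nonzero and primitive,
    -- hence a nonzero multiple of w.
    obtain ⟨n, hn⟩ : ∃ n, Nat.find (hnil u) = n + 1 :=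
      Nat.exists_eq_succ_of_ne_zero fun h0 => hu0 (by simpa [h0] using Nat.find_spec (hnil u))
    have h1 := Nat.find_spec (hnil u)
    rw [hn, pow_succ', Module.End.mul_apply] at h1
    have h2 : (σ.act xp1 ^ n) u ≠ 0 := Nat.find_min (hnil u) (by omega)
    obtain ⟨c, hc⟩ := mem_span_of_mem_cyclicSpan σ hw0 hw he hμ (hle (hmem n)) h1
    have hc0 : c ≠ 0 := by rintro rfl; exact h2 (by simpa using hc)
    have := N.smul_mem c⁻¹ (hmem n)
    rwa [hc, inv_smul_smul₀ hc0] at this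

end CyclicSpan

/-! ### Sums of highest weight modules -/

theorem isInternal_cyclicSpan (σ : SuperRep Osp12 M)
    (hnil : ∀ u : M, ∃ n : ℕ, (σ.act xp1 ^ n) u = 0) {ι : Type*} [Fintype ι] [DecidableEq ι]
    {w : ι → M} {μ : ι → ℂ} (hli : LinearIndependent ℂ w) (hw : ∀ j, σ.act h (w j) = μ j • w j)
    (hker : ∀ u, σ.act xp1 u = 0 ↔ u ∈ Submodule.span ℂ (Set.range w))
    (hμ : ∀ j, ∀ m : ℕ, μ j + m ≠ 0) :
    DirectSum.IsInternal fun j => cyclicSpan σ (w j) := by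
  have he : ∀ j, σ.act xp1 (w j) = 0 := fun j => (hker _).2 (Submodule.subset_span ⟨j, rfl⟩)
  rw [DirectSum.isInternal_submodule_iff_iSupIndep_and_iSup_eq_top]
  constructor
  · have key : ∀ (n : ℕ) (u : ι → M), (∀ j, u j ∈ cyclicSpan σ (w j)) →
        (∀ j, (σ.act xp1 ^ n) (u j) = 0) → ∑ j, u j = 0 → ∀ j, u j = 0 := by
      intro n
      induction n with
      | zero => intro u _ h0 _ j; simpa using h0 j
      | succ n ih =>
        intro u hu hn hsum
        have h1 := ih (fun j => σ.act xp1 (u j))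
          (fun j => act_xp1_mem_cyclicSpan σ (hw j) (he j) _ (hu j))
          (fun j => by rw [← Module.End.mul_apply, ← pow_succ]; exact hn j)
          (by rw [← map_sum, hsum, map_zero])
        choose c hc using fun j => mem_span_of_mem_cyclicSpan σ (hli.ne_zero j) (hw j) (he j)
          (hμ j) (hu j) (h1 j)
        simp only [hc] at hsum
        intro j
        rw [hc, Fintype.linearIndependent_iff.1 hli c hsum j, zero_smul]
    rw [iSupIndep_iff_finsetSum_eq_zero_imp_eq_zero]
    intro s u hu hsum j hj
    classical
    -- Extending the family by zero to all of ι permits one common exponent, the supremum of the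
    -- individual ones.
    let u' : ι → M := fun j => if j ∈ s then u j else 0
    have hu' : ∀ j, u' j ∈ cyclicSpan σ (w j) := fun j => by
      by_cases hj : j ∈ s
      · simpa [u', hj] using hu j hj
      · simp [u', hj]
    choose n hn using fun j => hnil (u' j)
    have hn' : ∀ j, (σ.act xp1 ^ (Finset.univ.sup n)) (u' j) = 0 := fun j => by
      have hle : n j ≤ Finset.univ.sup n := Finset.le_sup (Finset.mem_univ j)
      rw [← Nat.sub_add_cancel hle, pow_add, Module.End.mul_apply, hn, map_zero]
    have := key _ u' hu' hn' (by simpa [u', Finset.sum_ite_mem] using hsum) j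
    simpa [u', hj] using this
  · rw [eq_top_iff]
    rintro u -
    obtain ⟨n, hn⟩ := hnil u
    -- E is onto on the sum S, and ker E lies in S. If E u is in S, then E u = E z with z in S and u
    -- - z is in ker E; so induction on the nilpotency exponent puts every u in S.
    have hsurj : ∀ y ∈ ⨆ j, cyclicSpan σ (w j),
        ∃ z ∈ ⨆ j, cyclicSpan σ (w j), σ.act xp1 z = y := by
      intro y hy
      induction hy using Submodule.iSup_induction' with
      | mem j y hy =>
        obtain ⟨z, hz, e⟩ := exists_act_xp1_eq σ (hw j) (he j) (hμ j) hy
        exact ⟨z, Submodule.mem_iSup_of_mem j hz, e⟩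
      | zero => exact ⟨0, Submodule.zero_mem _, map_zero _⟩
      | add a b _ _ ha hb =>
        obtain ⟨y, hy, rfl⟩ := ha
        obtain ⟨z, hz, rfl⟩ := hb
        exact ⟨y + z, Submodule.add_mem _ hy hz, map_add _ _ _⟩
    have hk : Submodule.span ℂ (Set.range w) ≤ ⨆ j, cyclicSpan σ (w j) :=
      Submodule.span_le.2 fun _ ⟨j, e⟩ =>
        e ▸ Submodule.mem_iSup_of_mem j (self_mem_cyclicSpan σ (w j))
    induction n generalizing u with
    | zero =>
      have : u = 0 := by simpa using hn
      rw [this]; exact Submodule.zero_mem _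
    | succ n ih =>
      rw [pow_succ, Module.End.mul_apply] at hn
      obtain ⟨z, hz, e⟩ := hsurj _ (ih hn)
      have : u - z ∈ ⨆ j, cyclicSpan σ (w j) := hk ((hker _).1 (by rw [map_sub, e, sub_self]))
      simpa using Submodule.add_mem _ this hz

end Osp12

/-! ### The finite-dimensional irreducible representation -/

namespace Osp12

open LieSuperalgebra

section FiniteDimensional

variable {V : Type*} [AddCommGroup V] [Module ℂ V] (ρ : SuperRep Osp12 V)

theorem cyclicSpan_eq_top {w : V} {μ : ℂ} (hirr : ρ.IsIrreducible) {i : ZMod 2}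
    (hi : w ∈ ρ.part i) (hw0 : w ≠ 0) (hw : ρ.act h w = μ • w) (he : ρ.act xp1 w = 0) :
    cyclicSpan ρ w = ⊤ :=
  (hirr.2.2 _ (isSubrep_cyclicSpan ρ hi hw he) le_top).resolve_left fun hbot =>
    hw0 ((Submodule.mem_bot ℂ).1 (hbot ▸ self_mem_cyclicSpan ρ w))

/-- The nonzero F^k w are independent, so in finite dimension they stop at some first exponent,
which must be the dimension 2ℓ + 1. Applying E to F^{2ℓ+1} w = 0 yields a_{2ℓ+1} = μ + ℓ = 0. -/
theorem exists_basis_pow {ℓ : ℕ} (hdim : Module.finrank ℂ V = 2 * ℓ + 1) {w : V} {μ : ℂ}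
    (htop : cyclicSpan ρ w = ⊤) (hw : ρ.act h w = μ • w) (he : ρ.act xp1 w = 0) :
    μ = -(ℓ : ℂ) ∧ ∃ b : Module.Basis (Fin (2 * ℓ + 1)) ℂ V, ∀ k, b k = (ρ.act xm1 ^ (k : ℕ)) w := by
  classical
  have hfin : Module.Finite ℂ V := Module.finite_of_finrank_pos (by omega)
  have hex : ∃ k, (ρ.act xm1 ^ k) w = 0 := by
    by_contra! hne
    have := (linearIndependent_pow ρ (s := Set.univ) hw fun k _ => hne k).finite
    exact Set.infinite_univ (α := ℕ) (Set.toFinite _)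
  obtain ⟨n, hn⟩ : ∃ n, Nat.find hex = n := ⟨_, rfl⟩
  have hzero : ∀ k, n ≤ k → (ρ.act xm1 ^ k) w = 0 := by
    intro k hk
    have := Nat.find_spec hex
    rw [← Nat.sub_add_cancel hk, pow_add, Module.End.mul_apply, ← hn, this, map_zero]
  have hne : ∀ k, k < n → (ρ.act xm1 ^ k) w ≠ 0 := fun k hk => Nat.find_min hex (hn ▸ hk)
  have hli : LinearIndependent ℂ fun k : Fin n => (ρ.act xm1 ^ (k : ℕ)) w :=
    (linearIndependent_pow ρ (s := Set.Iio n) hw hne).comp (fun k : Fin n => ⟨k, k.2⟩)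
      fun a b hab => Fin.ext (congr_arg Subtype.val hab)
  have hspan : ⊤ ≤ Submodule.span ℂ (Set.range fun k : Fin n => (ρ.act xm1 ^ (k : ℕ)) w) := by
    rw [← htop]
    refine Submodule.span_le.2 ?_
    rintro _ ⟨k, rfl⟩
    by_cases hk : k < n
    · exact Submodule.subset_span ⟨⟨k, hk⟩, rfl⟩
    · simp only [hzero k (not_lt.1 hk)]
      exact Submodule.zero_mem _
  have hn' : n = 2 * ℓ + 1 := by
    rw [← hdim, Module.finrank_eq_card_basis (Module.Basis.mk hli hspan), Fintype.card_fin]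
  clear hn
  subst hn'
  refine ⟨?_, Module.Basis.mk hli hspan, fun k => by simp⟩
  have e := act_xp1_pow ρ hw he (2 * ℓ)
  rw [hzero _ le_rfl, map_zero, (raiseCoeff_two_mul μ ℓ).2] at e
  exact eq_neg_of_add_eq_zero_left ((smul_eq_zero.1 e.symm).resolve_right (hne _ (by omega)))

theorem eq_zero_of_add_mem_part {a b : V} {i : ZMod 2} (ha : a ∈ ρ.part i)
    (hb : b ∈ ρ.part (i + 1)) (hab : a + b = 0) : a = 0 ∧ b = 0 := by
  have key : a = 0 := by
    have ha' : a ∈ ρ.part (i + 1) := by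
      rw [eq_neg_of_add_eq_zero_left hab]; exact Submodule.neg_mem _ hb
    rcases zmod_two_cases i with rfl | rfl
    · exact Submodule.disjoint_def.1 ρ.isCompl_part.disjoint a ha (by simpa using ha')
    · exact Submodule.disjoint_def.1 ρ.isCompl_part.disjoint a
        (by simpa [zmod_two_one_add_one] using ha') ha
  exact ⟨key, by simpa [key] using hab⟩

/-- Subrepresentations are graded, so a homogeneous generator is required. Both homogeneous
components of v satisfy the equations of a highest weight vector; a nonzero one generates V, and the
weights ξ + k being distinct, the ξ-eigenspace is the line it spans. -/
theorem mem_part_of_isHighestWeightVector {ℓ : ℕ} (hirr : ρ.IsIrreducible)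
    (hdim : Module.finrank ℂ V = 2 * ℓ + 1) {ξ : ℂ} {v : V}
    (hv : IsHighestWeightVector ρ ξ v) : ∃ i, v ∈ ρ.part i := by
  obtain ⟨a, ha, b, hb, rfl⟩ := ρ.mem_decomp v
  obtain ⟨hv0, hvh, hve, -⟩ := hv
  have h1 := eq_zero_of_add_mem_part ρ (a := ρ.act h a - ξ • a) (b := ρ.act h b - ξ • b) (i := 0)
    (Submodule.sub_mem _ (ρ.act_mem h_mem_part ha) (Submodule.smul_mem _ _ ha))
    (Submodule.sub_mem _ (ρ.act_mem h_mem_part hb) (Submodule.smul_mem _ _ hb))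
    (by rw [map_add, smul_add] at hvh; rw [← sub_eq_zero] at hvh; rw [← hvh]; abel)
  have h2 := eq_zero_of_add_mem_part ρ (a := ρ.act xp1 a) (b := ρ.act xp1 b) (i := 1)
    (ρ.act_mem xp1_mem_part ha) (ρ.act_mem xp1_mem_part hb) (by rw [← map_add, hve])
  rw [sub_eq_zero, sub_eq_zero] at h1
  have key : ∀ w i, w ∈ ρ.part i → w ≠ 0 → ρ.act h w = ξ • w → ρ.act xp1 w = 0 →
      a + b ∈ ρ.part i := by
    intro w i hwi hw0 hw he
    obtain ⟨-, β, hβ⟩ := exists_basis_pow ρ hdim (cyclicSpan_eq_top ρ hirr hwi hw0 hw he) hw he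
    -- The k-th coordinate scales by ξ + k under h, but h acts on a + b by ξ.
    have hrepr : ∀ k : Fin (2 * ℓ + 1), (k : ℕ) ≠ 0 → β.repr (a + b) k = 0 := by
      intro k hk
      have e : ∀ u, β.coord k (ρ.act h u) = (ξ + (k : ℕ)) * β.coord k u := by
        intro u
        have : β.coord k ∘ₗ ρ.act h = (ξ + (k : ℕ)) • β.coord k := by
          refine β.ext fun m => ?_
          simp only [LinearMap.comp_apply, LinearMap.smul_apply]
          rw [hβ, act_h_pow ρ hw, ← hβ, map_smul, Module.Basis.coord_apply,
            Module.Basis.repr_self, Finsupp.single_apply]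
          split_ifs with hmk
          · rw [hmk]
          · simp
        exact congr($this u)
      have e1 := e (a + b)
      rw [hvh, map_smul, smul_eq_mul, add_mul, left_eq_add, mul_eq_zero] at e1
      exact e1.resolve_left (Nat.cast_ne_zero.2 hk)
    rw [← β.sum_repr (a + b), Finset.sum_eq_single 0 (fun k _ hk => by
      rw [hrepr k (fun h0 => hk (Fin.ext h0)), zero_smul]) (by simp), hβ]
    exact Submodule.smul_mem _ _ (by simpa using hwi)
  by_cases ha0 : a = 0
  · exact ⟨1, key b 1 hb (by rintro rfl; exact hv0 (by simp [ha0])) h1.2 h2.2⟩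
  · exact ⟨0, key a 0 ha ha0 h1.1 h2.1⟩

end FiniteDimensional

/-! ### The lowering operator on a tensor product -/

section Tensor

variable {V W : Type*} [AddCommGroup V] [Module ℂ V] [AddCommGroup W] [Module ℂ W]
variable (ρ : SuperRep Osp12 V) (σ : SuperRep Osp12 W)

theorem tensor_act (x : Osp12) : (ρ.tensor σ).act x = diag ρ σ x := rfl

/-- The operators x ⊗ 1 and 1 ⊗ y supercommute, so the cross terms drop out: the x̃ transform under
the diagonal action as in the adjoint representation. -/
theorem diag_mul_antidiag {i j : ZMod 2} {x y : Osp12}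
    (hx : x ∈ LieSuperalgebra.part (𝔤 := Osp12) i)
    (hy : y ∈ LieSuperalgebra.part (𝔤 := Osp12) j) (u : V ⊗[ℂ] W) :
    diag ρ σ x (antidiag ρ σ y u) = koszulSign i j • antidiag ρ σ y (diag ρ σ x u) +
      antidiag ρ σ (LieSuperalgebra.bracket x y) u := by
  suffices h : diag ρ σ x * antidiag ρ σ y = koszulSign i j • (antidiag ρ σ y * diag ρ σ x) +
      antidiag ρ σ (LieSuperalgebra.bracket x y) from congr($h u)
  refine ρ.tensor_ext σ fun k v hv w => ?_
  simp only [diag, antidiag, LinearMap.add_apply, LinearMap.sub_apply, LinearMap.smul_apply,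
    Module.End.mul_apply, SuperRep.actLeft_tmul, SuperRep.actRight_tmul ρ σ hx hv,
    SuperRep.actRight_tmul ρ σ hy hv, SuperRep.actRight_tmul ρ σ (bracket_mem hx hy) hv,
    map_add, map_sub, map_smul, SuperRep.actRight_tmul ρ σ hx (ρ.act_mem hy hv),
    SuperRep.actRight_tmul ρ σ hy (ρ.act_mem hx hv),
    ρ.act_bracket hx hy, σ.act_bracket hx hy, TensorProduct.sub_tmul, TensorProduct.tmul_sub,
    TensorProduct.tmul_smul, ← TensorProduct.smul_tmul']
  rcases zmod_two_cases i with rfl | rfl <;> rcases zmod_two_cases j with rfl | rfl <;>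
    rcases zmod_two_cases k with rfl | rfl <;>
    simp only [add_zero, zero_add, koszulSign_zero_left, koszulSign_zero_right,
      koszulSign_one_one, zmod_two_one_add_one] <;> module

theorem antidiag_mem {i k : ZMod 2} {x : Osp12}
    (hx : x ∈ LieSuperalgebra.part (𝔤 := Osp12) i) {u : V ⊗[ℂ] W}
    (hu : u ∈ (ρ.tensor σ).part k) : antidiag ρ σ x u ∈ (ρ.tensor σ).part (i + k) := by
  change u ∈ ρ.tensorPart σ k at hu
  change _ ∈ ρ.tensorPart σ (i + k)
  induction hu using Submodule.span_induction with
  | mem t h =>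
    obtain ⟨a, b, rfl, v, hv, w, hw, rfl⟩ := h
    rw [antidiag, LinearMap.sub_apply, SuperRep.actLeft_tmul, SuperRep.actRight_tmul ρ σ hx hv]
    exact Submodule.sub_mem _ (ρ.tmul_mem_tensorPart σ (ρ.act_mem hx hv) hw (by ring))
      (Submodule.smul_mem _ _ (ρ.tmul_mem_tensorPart σ hv (σ.act_mem hx hw) (by ring)))
  | zero => simp
  | add a b _ _ ha hb => rw [map_add]; exact Submodule.add_mem _ ha hb
  | smul c a _ ha => rw [map_smul]; exact Submodule.smul_mem _ _ ha

/-- Invertibility is essential here, since `Ring.inverse` is 0 on nonunits. -/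
theorem inverse_apply_of_eigenvector {M : Type*} [AddCommGroup M] [Module ℂ M]
    {f : Module.End ℂ M} (hf : IsUnit f) {c : ℂ} (hc : c ≠ 0) {u : M} (hu : f u = c • u) :
    Ring.inverse f u = c⁻¹ • u := by
  have e : Ring.inverse f (f u) = u := by
    rw [← Module.End.mul_apply, Ring.inverse_mul_cancel f hf, Module.End.one_apply]
  rw [hu, map_smul] at e
  rw [eq_inv_smul_iff₀ hc, e]

variable {ρ σ}

theorem diag_h_antidiag_xm1 (u : V ⊗[ℂ] W) : diag ρ σ h (antidiag ρ σ xm1 u) =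
    antidiag ρ σ xm1 (diag ρ σ h u) + antidiag ρ σ xm1 u := by
  rw [diag_mul_antidiag ρ σ h_mem_part xm1_mem_part, koszulSign_zero_left, one_smul]
  congr 3
  exact relations.1.2.1

theorem diag_h_antidiag_h (u : V ⊗[ℂ] W) : diag ρ σ h (antidiag ρ σ h u) =
    antidiag ρ σ h (diag ρ σ h u) := by
  have e : LieSuperalgebra.bracket h h = 0 := by
    change bracket h h = 0
    ext k; cases k <;> simp [bracket, h]
  rw [diag_mul_antidiag ρ σ h_mem_part h_mem_part, koszulSign_zero_left, one_smul, e]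
  simp [antidiag]

theorem diag_h_antidiag_xp1 (u : V ⊗[ℂ] W) : diag ρ σ h (antidiag ρ σ xp1 u) =
    antidiag ρ σ xp1 (diag ρ σ h u) - antidiag ρ σ xp1 u := by
  rw [diag_mul_antidiag ρ σ h_mem_part xp1_mem_part, koszulSign_zero_left, one_smul,
    show LieSuperalgebra.bracket h xp1 = -xp1 from relations.1.2.2.1]
  simp [antidiag]; abel

theorem diag_h_antidiag_xp2 (u : V ⊗[ℂ] W) : diag ρ σ h (antidiag ρ σ xp2 u) =
    antidiag ρ σ xp2 (diag ρ σ h u) - (2 : ℂ) • antidiag ρ σ xp2 u := by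
  rw [diag_mul_antidiag ρ σ h_mem_part xp2_mem_part, koszulSign_zero_left, one_smul,
    show LieSuperalgebra.bracket h xp2 = -((2 : ℂ) • xp2) from relations.1.2.2.2]
  simp [antidiag]; module

theorem diag_xp1_antidiag_xm1 (u : V ⊗[ℂ] W) : diag ρ σ xp1 (antidiag ρ σ xm1 u) =
    antidiag ρ σ h u - antidiag ρ σ xm1 (diag ρ σ xp1 u) := by
  have e : LieSuperalgebra.bracket xp1 xm1 = h := by
    change bracket xp1 xm1 = h
    ext k; cases k <;> simp [bracket, h, xp1, xm1]
  rw [diag_mul_antidiag ρ σ xp1_mem_part xm1_mem_part, koszulSign_one_one, e]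
  module

theorem diag_xp1_antidiag_h (u : V ⊗[ℂ] W) : diag ρ σ xp1 (antidiag ρ σ h u) =
    antidiag ρ σ h (diag ρ σ xp1 u) + antidiag ρ σ xp1 u := by
  have e : LieSuperalgebra.bracket xp1 h = xp1 := by
    change bracket xp1 h = xp1
    ext k; cases k <;> simp [bracket, h, xp1]
  rw [diag_mul_antidiag ρ σ xp1_mem_part h_mem_part, koszulSign_zero_right, e, one_smul]

theorem diag_xp1_antidiag_xp1 (u : V ⊗[ℂ] W) : diag ρ σ xp1 (antidiag ρ σ xp1 u) =
    -antidiag ρ σ xp1 (diag ρ σ xp1 u) - (2 : ℂ) • antidiag ρ σ xp2 u := by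
  rw [diag_mul_antidiag ρ σ xp1_mem_part xp1_mem_part, koszulSign_one_one,
    show LieSuperalgebra.bracket xp1 xp1 = -((2 : ℂ) • xp2) from relations.2.2.1.1]
  simp [antidiag]; module

theorem diag_xp1_antidiag_xp2 (u : V ⊗[ℂ] W) : diag ρ σ xp1 (antidiag ρ σ xp2 u) =
    antidiag ρ σ xp2 (diag ρ σ xp1 u) := by
  have e : LieSuperalgebra.bracket xp1 xp2 = 0 := by
    change bracket xp1 xp2 = 0
    ext k; cases k <;> simp [bracket, xp2, xp1]
  rw [diag_mul_antidiag ρ σ xp1_mem_part xp2_mem_part, koszulSign_zero_right, e, one_smul]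
  simp [antidiag]

theorem diag_xp1_diag_xm1 (u : V ⊗[ℂ] W) : diag ρ σ xp1 (diag ρ σ xm1 u) =
    diag ρ σ h u - diag ρ σ xm1 (diag ρ σ xp1 u) := act_xp1_xm1 (ρ.tensor σ) u

theorem diag_h_diag_xm1 (u : V ⊗[ℂ] W) : diag ρ σ h (diag ρ σ xm1 u) =
    diag ρ σ xm1 (diag ρ σ h u) + diag ρ σ xm1 u := act_h_xm1 (ρ.tensor σ) u

variable {u : V ⊗[ℂ] W} {μ : ℂ}

/-- The lowering operator on primitive weight vectors of weight `μ ≠ 0, 1`. -/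
theorem lowering_apply (h1 : IsUnit (diag ρ σ h - 1)) (h2 : IsUnit (diag ρ σ h - 2))
    (hμ0 : μ ≠ 0) (hμ1 : μ - 1 ≠ 0) (hu : diag ρ σ h u = μ • u) :
    lowering ρ σ u = antidiag ρ σ xm1 u - μ⁻¹ • diag ρ σ xm1 (antidiag ρ σ h u)
      - μ⁻¹ • diag ρ σ xm1 (diag ρ σ xm1 (antidiag ρ σ xp1 u))
      - (2 * ((μ - 1) * μ)⁻¹) •
        diag ρ σ xm1 (diag ρ σ xm1 (diag ρ σ xm1 (antidiag ρ σ xp2 u))) := by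
  -- The vectors to which the inverses are applied all have weight μ + 1, where H - 1 is μ and (H -
  -- 2)(H - 1) is (μ - 1)μ.
  have e1 : diag ρ σ h (diag ρ σ xm1 (antidiag ρ σ h u)) =
      (μ + 1) • diag ρ σ xm1 (antidiag ρ σ h u) := by
    simp only [diag_h_diag_xm1, diag_h_antidiag_h, hu, map_smul]; module
  have e2 : diag ρ σ h (diag ρ σ xm1 (diag ρ σ xm1 (antidiag ρ σ xp1 u))) =
      (μ + 1) • diag ρ σ xm1 (diag ρ σ xm1 (antidiag ρ σ xp1 u)) := by
    simp only [diag_h_diag_xm1, diag_h_antidiag_xp1, hu, map_smul, map_sub, map_add]; module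
  have e3 : diag ρ σ h (diag ρ σ xm1 (diag ρ σ xm1 (diag ρ σ xm1 (antidiag ρ σ xp2 u)))) =
      (μ + 1) • diag ρ σ xm1 (diag ρ σ xm1 (diag ρ σ xm1 (antidiag ρ σ xp2 u))) := by
    simp only [diag_h_diag_xm1, diag_h_antidiag_xp2, hu, map_smul, map_sub, map_add]; module
  have k1 : ∀ y, diag ρ σ h y = (μ + 1) • y → (diag ρ σ h - 1) y = μ • y := by
    intro y hy
    rw [LinearMap.sub_apply, hy, Module.End.one_apply]; module
  have k2 : ∀ y, diag ρ σ h y = (μ + 1) • y →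
      ((diag ρ σ h - 2) * (diag ρ σ h - 1)) y = ((μ - 1) * μ) • y := by
    intro y hy
    have : (2 : Module.End ℂ (V ⊗[ℂ] W)) y = (2 : ℂ) • y := by
      rw [two_smul, ← one_add_one_eq_two]; rfl
    rw [Module.End.mul_apply, k1 y hy, map_smul, LinearMap.sub_apply, hy, this]; module
  simp only [lowering, LinearMap.sub_apply, Module.End.mul_apply, LinearMap.smul_apply, pow_succ,
    pow_zero, one_mul]
  rw [inverse_apply_of_eigenvector h1 hμ0 (k1 _ e1), inverse_apply_of_eigenvector h1 hμ0 (k1 _ e2),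
    inverse_apply_of_eigenvector (h2.mul h1) (mul_ne_zero hμ1 hμ0) (k2 _ e3), mul_smul]

theorem diag_h_lowering (h1 : IsUnit (diag ρ σ h - 1)) (h2 : IsUnit (diag ρ σ h - 2))
    (hμ0 : μ ≠ 0) (hμ1 : μ - 1 ≠ 0) (hu : diag ρ σ h u = μ • u) :
    diag ρ σ h (lowering ρ σ u) = (μ + 1) • lowering ρ σ u := by
  rw [lowering_apply h1 h2 hμ0 hμ1 hu]
  simp only [map_sub, map_add, map_smul, diag_h_diag_xm1, diag_h_antidiag_xm1, diag_h_antidiag_h,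
    diag_h_antidiag_xp1, diag_h_antidiag_xp2, hu]
  module

/-- The coefficients of T make a telescoping cancellation. With X = X_{-α} and X_α u = 0, X_α sends
x̃_{-α}u to h̃u, X h̃u to μ h̃u - X x̃_α u, X² x̃_α u to X x̃_α u - 2X² x̃_{2α}u, and X³ x̃_{2α}u to
(μ - 1) X² x̃_{2α}u. -/
theorem diag_xp1_lowering (h1 : IsUnit (diag ρ σ h - 1)) (h2 : IsUnit (diag ρ σ h - 2))
    (hμ0 : μ ≠ 0) (hμ1 : μ - 1 ≠ 0) (hu : diag ρ σ h u = μ • u) (he : diag ρ σ xp1 u = 0) :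
    diag ρ σ xp1 (lowering ρ σ u) = 0 := by
  rw [lowering_apply h1 h2 hμ0 hμ1 hu]
  simp only [map_sub, map_add, map_smul, map_neg, diag_xp1_diag_xm1, diag_h_diag_xm1,
    diag_xp1_antidiag_xm1, diag_xp1_antidiag_h, diag_xp1_antidiag_xp1, diag_xp1_antidiag_xp2,
    diag_h_antidiag_h, diag_h_antidiag_xp1, diag_h_antidiag_xp2, hu, he, map_zero]
  match_scalars <;> field_simp <;> ring

/-- T is odd; this keeps the vectors T^j(1 ⊗ v) homogeneous, as graded subrepresentations demand. -/
theorem lowering_mem (h1 : IsUnit (diag ρ σ h - 1)) (h2 : IsUnit (diag ρ σ h - 2))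
    (hμ0 : μ ≠ 0) (hμ1 : μ - 1 ≠ 0) (hu : diag ρ σ h u = μ • u) {i : ZMod 2}
    (hi : u ∈ (ρ.tensor σ).part i) : lowering ρ σ u ∈ (ρ.tensor σ).part (1 + i) := by
  have hF : ∀ {k : ZMod 2} {y}, y ∈ (ρ.tensor σ).part k →
      diag ρ σ xm1 y ∈ (ρ.tensor σ).part (1 + k) := fun hy => (ρ.tensor σ).act_mem xm1_mem_part hy
  have e : ∀ k : ZMod 2, 1 + (1 + k) = k := by decide
  have m1 := antidiag_mem ρ σ xm1_mem_part hi
  have m2 := hF (antidiag_mem ρ σ h_mem_part hi)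
  have m3 := hF (hF (antidiag_mem ρ σ xp1_mem_part hi))
  have m4 := hF (hF (hF (antidiag_mem ρ σ xp2_mem_part hi)))
  simp only [e, zero_add] at m1 m2 m3 m4
  rw [lowering_apply h1 h2 hμ0 hμ1 hu]
  exact Submodule.sub_mem _ (Submodule.sub_mem _ (Submodule.sub_mem _ m1
    (Submodule.smul_mem _ _ m2)) (Submodule.smul_mem _ _ m3)) (Submodule.smul_mem _ _ m4)

end Tensor

end Osp12

/-! ### Constant coefficients in ℂ[x] ⊗ V -/

namespace Osp12

open LieSuperalgebra

theorem isUnit_of_basis_eigenvector {ι M : Type*} [AddCommGroup M] [Module ℂ M]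
    (b : Module.Basis ι ℂ M) {f : Module.End ℂ M} {c : ι → ℂ} (hc : ∀ i, c i ≠ 0)
    (hf : ∀ i, f (b i) = c i • b i) : IsUnit f := by
  let g : Module.End ℂ M := b.constr ℂ fun i => (c i)⁻¹ • b i
  have hg : ∀ i, g (b i) = (c i)⁻¹ • b i := fun i => b.constr_basis ℂ _ i
  refine ⟨⟨f, g, b.ext fun i => ?_, b.ext fun i => ?_⟩, rfl⟩
  · rw [Module.End.mul_apply, hg, map_smul, hf, inv_smul_smul₀ (hc i), Module.End.one_apply]
  · rw [Module.End.mul_apply, hf, map_smul, hg, smul_inv_smul₀ (hc i), Module.End.one_apply]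

variable {V : Type*} [AddCommGroup V] [Module ℂ V] (ρ : SuperRep Osp12 V)

/-- The coefficient of `x ^ n` of an element of `ℂ[x] ⊗ V`. -/
noncomputable def tensorCoeff (V : Type*) [AddCommGroup V] [Module ℂ V] (n : ℕ) :
    ℂ[X] ⊗[ℂ] V →ₗ[ℂ] V :=
  TensorProduct.lid ℂ V ∘ₗ (lcoeff ℂ n).rTensor V

theorem tensorCoeff_tmul (n : ℕ) (p : ℂ[X]) (y : V) :
    tensorCoeff V n (p ⊗ₜ y) = p.coeff n • y := by simp [tensorCoeff]

theorem eq_zero_of_tensorCoeff_eq_zero {u : ℂ[X] ⊗[ℂ] V} (hu : ∀ n, tensorCoeff V n u = 0) :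
    u = 0 := by
  apply (TensorProduct.equivFinsuppOfBasisLeft (N := V) (basisMonomials ℂ)).injective
  rw [map_zero]
  ext n
  rw [TensorProduct.equivFinsuppOfBasisLeft_apply, Finsupp.zero_apply]
  have e : (basisMonomials ℂ).coord n = lcoeff ℂ n := by ext p; rfl
  rw [e]
  exact hu n

theorem act_polyRep_xm1 (p : ℂ[X]) : polyRep.act xm1 p = (1 / 2 : ℂ) • (X * p) := by
  change polyAct _ _ = _
  simp [polyAct_apply, xm1]

theorem act_polyRep_h (p : ℂ[X]) :
    polyRep.act h p = X * derivative p + (1 / 2 : ℂ) • p := by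
  change polyAct _ _ = _
  simp [polyAct_apply, h]

theorem act_polyRep_xp1 (p : ℂ[X]) : polyRep.act xp1 p = derivative p := by
  change polyAct _ _ = _
  simp [polyAct_apply, xp1]

theorem X_pow_mem_part (n : ℕ) : (X ^ n : ℂ[X]) ∈ polyRep.part n := by
  intro m hm
  rw [coeff_X_pow, if_neg]
  rintro rfl
  exact hm rfl

theorem diag_xp1_X_pow (n : ℕ) (y : V) : diag polyRep ρ xp1 ((X ^ n : ℂ[X]) ⊗ₜ y) =
    (n : ℂ) • ((X ^ (n - 1) : ℂ[X]) ⊗ₜ y) + koszulSign 1 n • ((X ^ n : ℂ[X]) ⊗ₜ ρ.act xp1 y) := by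
  rw [diag, LinearMap.add_apply, SuperRep.actLeft_tmul,
    SuperRep.actRight_tmul polyRep ρ xp1_mem_part (X_pow_mem_part n), act_polyRep_xp1,
    derivative_X_pow, ← smul_eq_C_mul, ← TensorProduct.smul_tmul']

theorem diag_h_X_pow {y : V} {c : ℂ} (hy : ρ.act h y = c • y) (n : ℕ) :
    diag polyRep ρ h ((X ^ n : ℂ[X]) ⊗ₜ y) = ((n : ℂ) + 1 / 2 + c) • ((X ^ n : ℂ[X]) ⊗ₜ y) := by
  have e : X * derivative (X ^ n : ℂ[X]) = (n : ℂ) • X ^ n := by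
    rcases n with _ | n
    · simp
    · rw [derivative_X_pow, ← smul_eq_C_mul, mul_smul_comm, Nat.add_sub_cancel, ← pow_succ']
  rw [diag, LinearMap.add_apply, SuperRep.actLeft_tmul,
    SuperRep.actRight_tmul polyRep ρ h_mem_part (X_pow_mem_part n), act_polyRep_h, e,
    koszulSign_zero_left, one_smul, hy, TensorProduct.tmul_smul, TensorProduct.add_tmul,
    ← TensorProduct.smul_tmul', ← TensorProduct.smul_tmul']
  module

theorem span_X_pow_tmul : Submodule.span ℂ (Set.range fun q : ℕ × V => (X ^ q.1 : ℂ[X]) ⊗ₜ[ℂ] q.2)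
    = ⊤ := by
  rw [eq_top_iff, ← TensorProduct.span_tmul_eq_top, Submodule.span_le]
  rintro _ ⟨p, y, rfl⟩
  induction p using Polynomial.induction_on' with
  | add p q hp hq => rw [TensorProduct.add_tmul]; exact Submodule.add_mem _ hp hq
  | monomial n a =>
    rw [← C_mul_X_pow_eq_monomial, ← smul_eq_C_mul, ← TensorProduct.smul_tmul']
    exact Submodule.smul_mem _ _ (Submodule.subset_span ⟨(n, y), rfl⟩)

theorem hom_ext_X_pow {N : Type*} [AddCommGroup N] [Module ℂ N] {f g : ℂ[X] ⊗[ℂ] V →ₗ[ℂ] N}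
    (hfg : ∀ n (y : V), f ((X ^ n : ℂ[X]) ⊗ₜ y) = g ((X ^ n : ℂ[X]) ⊗ₜ y)) : f = g :=
  LinearMap.ext_on_range span_X_pow_tmul fun q => hfg q.1 q.2

/-- The first term is d/dx on coefficients; in the second, x^n has parity n, whence the Koszul sign.
-/
theorem tensorCoeff_diag_xp1 (n : ℕ) (u : ℂ[X] ⊗[ℂ] V) :
    tensorCoeff V n (diag polyRep ρ xp1 u) =
      ((n : ℂ) + 1) • tensorCoeff V (n + 1) u + koszulSign 1 n • ρ.act xp1 (tensorCoeff V n u) := by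
  suffices e : tensorCoeff V n ∘ₗ diag polyRep ρ xp1 = ((n : ℂ) + 1) • tensorCoeff V (n + 1) +
      koszulSign 1 n • (ρ.act xp1 ∘ₗ tensorCoeff V n) from congr($e u)
  refine hom_ext_X_pow fun m y => ?_
  simp only [LinearMap.comp_apply, LinearMap.add_apply, LinearMap.smul_apply, diag_xp1_X_pow,
    map_add, map_smul, tensorCoeff_tmul, coeff_X_pow]
  congr 1
  · rcases m with _ | m
    · simp
    · by_cases hm : n = m
      · simp [hm]
      · simp [hm]
  · by_cases hm : n = m
    · simp [hm]
    · simp [hm]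

/-- For u killed by X_α the coefficients obey (n + 1) u_{n+1} = ± E u_n, so u_0 determines them all.
-/
theorem eq_zero_of_tensorCoeff_zero {u : ℂ[X] ⊗[ℂ] V} (he : diag polyRep ρ xp1 u = 0)
    (hu : tensorCoeff V 0 u = 0) : u = 0 := by
  refine eq_zero_of_tensorCoeff_eq_zero fun n => ?_
  induction n with
  | zero => exact hu
  | succ n ih =>
    have e := tensorCoeff_diag_xp1 ρ n u
    rw [he, ih, map_zero, map_zero, smul_zero, add_zero] at e
    exact (smul_eq_zero.1 e.symm).resolve_left (Nat.cast_add_one_ne_zero n)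

theorem tensorCoeff_zero_actRight {i : ZMod 2} {x : Osp12}
    (hx : x ∈ LieSuperalgebra.part (𝔤 := Osp12) i) (u : ℂ[X] ⊗[ℂ] V) :
    tensorCoeff V 0 (polyRep.actRight ρ x u) = ρ.act x (tensorCoeff V 0 u) := by
  suffices e : tensorCoeff V 0 ∘ₗ polyRep.actRight ρ x = ρ.act x ∘ₗ tensorCoeff V 0 from
    congr($e u)
  refine hom_ext_X_pow fun m y => ?_
  simp only [LinearMap.comp_apply, SuperRep.actRight_tmul polyRep ρ hx (X_pow_mem_part m),
    map_smul, tensorCoeff_tmul, coeff_X_pow]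
  rcases m with _ | m
  · simp [koszulSign_zero_right]
  · simp

theorem tensorCoeff_zero_actLeft_xm1 (u : ℂ[X] ⊗[ℂ] V) :
    tensorCoeff V 0 (polyRep.actLeft ρ xm1 u) = 0 := by
  suffices e : tensorCoeff V 0 ∘ₗ polyRep.actLeft ρ xm1 = 0 from congr($e u)
  refine hom_ext_X_pow fun m y => ?_
  simp [SuperRep.actLeft_tmul, tensorCoeff_tmul, act_polyRep_xm1]

theorem tensorCoeff_zero_actLeft_h (u : ℂ[X] ⊗[ℂ] V) :
    tensorCoeff V 0 (polyRep.actLeft ρ h u) = (1 / 2 : ℂ) • tensorCoeff V 0 u := by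
  suffices e : tensorCoeff V 0 ∘ₗ polyRep.actLeft ρ h = (1 / 2 : ℂ) • tensorCoeff V 0 from
    congr($e u)
  refine hom_ext_X_pow fun m y => ?_
  simp [SuperRep.actLeft_tmul, tensorCoeff_tmul, act_polyRep_h]

theorem tensorCoeff_zero_diag_xm1 (u : ℂ[X] ⊗[ℂ] V) :
    tensorCoeff V 0 (diag polyRep ρ xm1 u) = ρ.act xm1 (tensorCoeff V 0 u) := by
  rw [diag, LinearMap.add_apply, map_add, tensorCoeff_zero_actLeft_xm1,
    tensorCoeff_zero_actRight ρ xm1_mem_part, zero_add]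

/-- x̃ = X - 2(1 ⊗ x). On a primitive weight vector X_α, X_{2α} and H act by known scalars, so the
constant coefficient of T u can be computed inside V. -/
theorem tensorCoeff_zero_antidiag {i : ZMod 2} {x : Osp12}
    (hx : x ∈ LieSuperalgebra.part (𝔤 := Osp12) i) (u : ℂ[X] ⊗[ℂ] V) :
    tensorCoeff V 0 (antidiag polyRep ρ x u) =
      tensorCoeff V 0 (diag polyRep ρ x u) - (2 : ℂ) • ρ.act x (tensorCoeff V 0 u) := by
  rw [← tensorCoeff_zero_actRight ρ hx, diag, antidiag, LinearMap.add_apply, LinearMap.sub_apply,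
    map_add, map_sub]
  module

variable {ρ}

theorem act_h_tensorCoeff_zero {u : ℂ[X] ⊗[ℂ] V} {μ : ℂ} (hu : diag polyRep ρ h u = μ • u) :
    ρ.act h (tensorCoeff V 0 u) = (μ - 1 / 2) • tensorCoeff V 0 u := by
  have e := congr(tensorCoeff V 0 $hu)
  rw [diag, LinearMap.add_apply, map_add, tensorCoeff_zero_actLeft_h,
    tensorCoeff_zero_actRight ρ h_mem_part, map_smul] at e
  rw [sub_smul, ← e]
  abel

theorem tensorCoeff_zero_lowering {u : ℂ[X] ⊗[ℂ] V} {μ : ℂ}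
    (h1 : IsUnit (diag polyRep ρ h - 1)) (h2 : IsUnit (diag polyRep ρ h - 2))
    (hμ0 : μ ≠ 0) (hμ1 : μ - 1 ≠ 0) (hu : diag polyRep ρ h u = μ • u)
    (he : diag polyRep ρ xp1 u = 0) {y : V} (hy : tensorCoeff V 0 u = y) :
    tensorCoeff V 0 (lowering polyRep ρ u) =
      μ⁻¹ • (-ρ.act xm1 y + (2 : ℂ) • ρ.act xm1 (ρ.act xm1 (ρ.act xp1 y))
        - (4 * (μ - 1)⁻¹) •
          ρ.act xm1 (ρ.act xm1 (ρ.act xm1 (ρ.act xp1 (ρ.act xp1 y))))) := by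
  subst hy
  have he2 : diag polyRep ρ xp2 u = 0 := by
    have := act_xp2 (polyRep.tensor ρ) u
    simp only [tensor_act, he, map_zero, neg_zero] at this
    exact this
  rw [lowering_apply h1 h2 hμ0 hμ1 hu]
  simp only [map_sub, map_smul, tensorCoeff_zero_diag_xm1,
    tensorCoeff_zero_antidiag ρ xm1_mem_part, tensorCoeff_zero_antidiag ρ h_mem_part,
    tensorCoeff_zero_antidiag ρ xp1_mem_part, tensorCoeff_zero_antidiag ρ xp2_mem_part, hu, he, he2,
    act_h_tensorCoeff_zero hu, map_zero, act_xp2, map_neg]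
  match_scalars <;> field_simp <;> ring

/-- On constant coefficients the lowering operator maps `x_{-α}^j v` to a multiple of
`x_{-α}^{j+1} v`; up to the weight this is the scalar. -/
theorem lowering_scalar_ne_zero (ℓ j : ℕ) :
    -1 + 2 * raiseCoeff (-ℓ) j - 4 * ((1 / 2 - ℓ + j : ℂ) - 1)⁻¹ *
      (raiseCoeff (-ℓ) j * raiseCoeff (-ℓ) (j - 1)) ≠ 0 := by
  have half : ∀ z : ℤ, (2 * (z : ℂ) + 1) ≠ 0 := fun z hz => by
    have : 2 * z + 1 = 0 := by exact_mod_cast hz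
    omega
  obtain ⟨m, rfl | rfl⟩ := Nat.even_or_odd' j
  · rcases m with _ | m
    · simp [raiseCoeff]
    · have hd := half (2 * m + 1 - ℓ)
      rw [(raiseCoeff_two_mul _ _).1, show 2 * (m + 1) - 1 = 2 * m + 1 by omega,
        (raiseCoeff_two_mul _ _).2]
      have e0 : ((1 / 2 - ℓ + (2 * (m + 1) : ℕ) : ℂ) - 1) = (2 * ((2 * m + 1 - ℓ : ℤ) : ℂ) + 1) / 2 := by
        push_cast; ring
      rw [e0]
      intro h0
      -- Clearing the denominator makes the scalar for j = 2(m + 1) a product of two odd integers.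
      have e1 : (2 * ((m : ℂ) + 1) + 1) * (2 * ℓ + 1) = 0 := by
        field_simp at h0
        push_cast at h0
        linear_combination h0
      rcases mul_eq_zero.1 e1 with e | e
      · exact half (m + 1) (by push_cast; exact e)
      · exact half ℓ (by push_cast; exact e)
  · have hd := half (2 * m - ℓ)
    rw [Nat.add_sub_cancel, (raiseCoeff_two_mul _ _).1, (raiseCoeff_two_mul _ _).2]
    have e0 : ((1 / 2 - ℓ + (2 * m + 1 : ℕ) : ℂ) - 1) = (2 * ((2 * m - ℓ : ℤ) : ℂ) + 1) / 2 := by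
      push_cast; ring
    rw [e0]
    intro h0
    -- For j = 2m + 1 the cleared scalar is again a product of two odd integers.
    have e1 : (2 * (ℓ : ℂ) + 1) * (2 * (ℓ - 1 - m) + 1) = 0 := by
      field_simp at h0
      push_cast at h0
      linear_combination h0
    rcases mul_eq_zero.1 e1 with e | e
    · exact half ℓ (by push_cast; exact e)
    · exact half (ℓ - 1 - m) (by push_cast; exact e)

/-- Doubling gives a parity contradiction. This single fact excludes every bad weight: 0 and 1 for
T, and the nonpositive integers for irreducibility. -/
theorem half_sub_add_ne_intCast (ℓ j : ℕ) (z : ℤ) : (1 / 2 - ℓ + j : ℂ) ≠ z := by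
  intro e
  have : (1 : ℂ) + 2 * ((j : ℤ) - (ℓ : ℤ) - z : ℤ) = 0 := by
    push_cast; linear_combination 2 * e
  have : 1 + 2 * ((j : ℤ) - (ℓ : ℤ) - z) = 0 := by exact_mod_cast this
  omega

variable (ρ) in
theorem exists_pow_diag_xp1_eq_zero {v : V} {ξ : ℂ} (htop : cyclicSpan ρ v = ⊤)
    (hw : ρ.act h v = ξ • v) (he : ρ.act xp1 v = 0) (u : ℂ[X] ⊗[ℂ] V) :
    ∃ n : ℕ, (diag polyRep ρ xp1 ^ n) u = 0 := by
  -- Each application of X_α to x^n ⊗ F^k v lowers either n or k by one, so n + k + 1 applications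
  -- suffice.
  have key : ∀ s n k : ℕ, n + k < s →
      (diag polyRep ρ xp1 ^ s) ((X ^ n : ℂ[X]) ⊗ₜ (ρ.act xm1 ^ k) v) = 0 := by
    intro s
    induction s with
    | zero => intro n k hnk; omega
    | succ s ih =>
      intro n k hnk
      rw [pow_succ, Module.End.mul_apply, diag_xp1_X_pow, map_add, map_smul, map_smul]
      have a1 : (n : ℂ) • (diag polyRep ρ xp1 ^ s) ((X ^ (n - 1) : ℂ[X]) ⊗ₜ (ρ.act xm1 ^ k) v)
          = 0 := by
        rcases n with _ | n
        · simp
        · rw [ih _ _ (by omega), smul_zero]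
      rw [a1, zero_add]
      rcases k with _ | k
      · simp [he]
      · rw [act_xp1_pow ρ hw he, TensorProduct.tmul_smul, map_smul, ih _ _ (by omega), smul_zero,
          smul_zero]
  have hspan : u ∈ Submodule.span ℂ (Set.range fun q : ℕ × V => (X ^ q.1 : ℂ[X]) ⊗ₜ[ℂ] q.2) :=
    span_X_pow_tmul (V := V) ▸ Submodule.mem_top
  have hadd : ∀ a b : ℂ[X] ⊗[ℂ] V, (∃ n : ℕ, (diag polyRep ρ xp1 ^ n) a = 0) →
      (∃ n : ℕ, (diag polyRep ρ xp1 ^ n) b = 0) → ∃ n : ℕ, (diag polyRep ρ xp1 ^ n) (a + b) = 0 := by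
    rintro a b ⟨n, hn⟩ ⟨m, hm⟩
    refine ⟨n + m, ?_⟩
    rw [map_add]
    conv_lhs => arg 1; rw [add_comm n m]
    rw [pow_add, pow_add, Module.End.mul_apply, Module.End.mul_apply, hn, hm, map_zero, map_zero,
      add_zero]
  have hsmul : ∀ (c : ℂ) (a : ℂ[X] ⊗[ℂ] V), (∃ n : ℕ, (diag polyRep ρ xp1 ^ n) a = 0) →
      ∃ n : ℕ, (diag polyRep ρ xp1 ^ n) (c • a) = 0 := by
    rintro c a ⟨n, hn⟩
    exact ⟨n, by rw [map_smul, hn, smul_zero]⟩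
  induction hspan using Submodule.span_induction with
  | mem t ht =>
    obtain ⟨⟨n, y⟩, rfl⟩ := ht
    have hy : y ∈ cyclicSpan ρ v := htop ▸ Submodule.mem_top
    induction hy using Submodule.span_induction with
    | mem y hy =>
      obtain ⟨k, rfl⟩ := hy
      exact ⟨n + k + 1, key _ n k (by omega)⟩
    | zero => exact ⟨0, by simp⟩
    | add a b _ _ ha hb => simp only [TensorProduct.tmul_add]; exact hadd _ _ ha hb
    | smul c a _ ha => simp only [TensorProduct.tmul_smul]; exact hsmul _ _ ha
  | zero => exact ⟨0, by simp⟩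
  | add a b _ _ ha hb => exact hadd _ _ ha hb
  | smul c a _ ha => exact hsmul _ _ ha

/-- H is diagonal in the basis x^n ⊗ F^k v, with eigenvalues 1/2 - ℓ + n + k outside ℤ. -/
theorem isUnit_diag_h_sub {ℓ : ℕ} {v : V} (b : Module.Basis (Fin (2 * ℓ + 1)) ℂ V)
    (hb : ∀ k, b k = (ρ.act xm1 ^ (k : ℕ)) v) (hw : ρ.act h v = (-(ℓ : ℂ)) • v) (z : ℤ) :
    IsUnit (diag polyRep ρ h - (z : Module.End ℂ (ℂ[X] ⊗[ℂ] V))) := by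
  refine isUnit_of_basis_eigenvector ((basisMonomials ℂ).tensorProduct b)
    (c := fun q => (1 / 2 - ℓ + (q.1 + q.2 : ℕ) : ℂ) - z)
    (fun q => sub_ne_zero.2 (half_sub_add_ne_intCast _ _ _)) ?_
  rintro ⟨n, k⟩
  rw [Module.Basis.tensorProduct_apply, coe_basisMonomials]
  beta_reduce
  rw [← X_pow_eq_monomial, hb, LinearMap.sub_apply, diag_h_X_pow ρ (act_h_pow ρ hw k), Module.End.intCast_apply,
    ← Int.cast_smul_eq_zsmul ℂ]
  push_cast
  module

end Osp12

/-! ### The decomposition of ℂ[x] ⊗ V(-ℓ) -/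

theorem theorem3 (ℓ : ℕ) {V : Type*} [AddCommGroup V] [Module ℂ V] (ρ : SuperRep Osp12 V)
    (hirr : ρ.IsIrreducible) (hdim : Module.finrank ℂ V = 2 * ℓ + 1)
    (ξ : ℂ) (v : V) (hv : Osp12.IsHighestWeightVector ρ ξ v) :
    ξ = -(ℓ : ℂ) ∧
    IsUnit (Osp12.diag Osp12.polyRep ρ Osp12.h - 1) ∧
    IsUnit (Osp12.diag Osp12.polyRep ρ Osp12.h - 2) ∧
    (∀ j : Fin (2 * ℓ + 1),
      (Osp12.lowering Osp12.polyRep ρ ^ (j : ℕ)) ((1 : ℂ[X]) ⊗ₜ[ℂ] v) ≠ 0 ∧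
      Osp12.IsPrimitive (Osp12.polyRep.tensor ρ)
        ((Osp12.lowering Osp12.polyRep ρ ^ (j : ℕ)) ((1 : ℂ[X]) ⊗ₜ[ℂ] v)) ∧
      (Osp12.polyRep.tensor ρ).IsIrreducibleSubrep
        ((Osp12.polyRep.tensor ρ).orbit Osp12.envNMinus
          ((Osp12.lowering Osp12.polyRep ρ ^ (j : ℕ)) ((1 : ℂ[X]) ⊗ₜ[ℂ] v)))) ∧
    DirectSum.IsInternal (fun j : Fin (2 * ℓ + 1) =>
      (Osp12.polyRep.tensor ρ).orbit Osp12.envNMinus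
        ((Osp12.lowering Osp12.polyRep ρ ^ (j : ℕ)) ((1 : ℂ[X]) ⊗ₜ[ℂ] v))) := by
  open Osp12 in
  obtain ⟨i, hi⟩ := mem_part_of_isHighestWeightVector ρ hirr hdim hv
  obtain ⟨hv0, hvh, hve, -⟩ := hv
  have htop := cyclicSpan_eq_top ρ hirr hi hv0 hvh hve
  obtain ⟨rfl, b, hb⟩ := exists_basis_pow ρ hdim htop hvh hve
  have u1 : IsUnit (diag polyRep ρ h - 1) := by
    simpa using isUnit_diag_h_sub b hb hvh 1
  have u2 : IsUnit (diag polyRep ρ h - 2) := by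
    simpa using isUnit_diag_h_sub b hb hvh 2
  have hnil : ∀ u, ∃ n : ℕ, ((polyRep.tensor ρ).act xp1 ^ n) u = 0 :=
    exists_pow_diag_xp1_eq_zero ρ htop hvh hve
  have hμz : ∀ (j : ℕ) (z : ℤ), (1 / 2 - ℓ + j : ℂ) - z ≠ 0 := fun j z =>
    sub_ne_zero.2 (half_sub_add_ne_intCast ℓ j z)
  have hμ0 : ∀ j : ℕ, (1 / 2 - ℓ + j : ℂ) ≠ 0 := fun j => by simpa using hμz j 0
  have hμ1 : ∀ j : ℕ, (1 / 2 - ℓ + j : ℂ) - 1 ≠ 0 := fun j => by simpa using hμz j 1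
  have hμ : ∀ j m : ℕ, (1 / 2 - ℓ + j : ℂ) + m ≠ 0 := fun j m => by simpa using hμz j (-m)
  -- The properties are carried together because each step needs the weight and primitivity of the
  -- previous vector. For j > 2ℓ the last one is vacuous, as F^j v = 0.
  have main : ∀ j : ℕ, diag polyRep ρ h ((lowering polyRep ρ ^ j) (1 ⊗ₜ v)) =
        (1 / 2 - ℓ + j : ℂ) • (lowering polyRep ρ ^ j) (1 ⊗ₜ v) ∧
      diag polyRep ρ xp1 ((lowering polyRep ρ ^ j) (1 ⊗ₜ v)) = 0 ∧
      (∃ k, (lowering polyRep ρ ^ j) (1 ⊗ₜ v) ∈ (polyRep.tensor ρ).part k) ∧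
      ∃ c : ℂ, c ≠ 0 ∧ tensorCoeff V 0 ((lowering polyRep ρ ^ j) (1 ⊗ₜ v)) =
        c • (ρ.act xm1 ^ j) v := by
    intro j
    induction j with
    | zero =>
      refine ⟨?_, ?_, ⟨i, ?_⟩, 1, one_ne_zero, ?_⟩
      · have := diag_h_X_pow ρ hvh 0
        simp only [pow_zero] at this
        rw [pow_zero, Module.End.one_apply, this]
        push_cast; congr 1; ring
      · have := diag_xp1_X_pow ρ 0 v
        simpa [hve] using this
      · exact polyRep.tmul_mem_tensorPart ρ (by simpa using X_pow_mem_part 0) hi (zero_add i)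
      · simp [tensorCoeff_tmul]
    | succ j ih =>
      obtain ⟨ih1, ih2, ⟨k, ih3⟩, c, hc, ih4⟩ := ih
      simp only [pow_succ', Module.End.mul_apply]
      refine ⟨?_, diag_xp1_lowering u1 u2 (hμ0 j) (hμ1 j) ih1 ih2,
        ⟨1 + k, lowering_mem u1 u2 (hμ0 j) (hμ1 j) ih1 ih3⟩,
        (1 / 2 - ℓ + j : ℂ)⁻¹ * ((-1 + 2 * raiseCoeff (-ℓ) j - 4 * ((1 / 2 - ℓ + j : ℂ) - 1)⁻¹ *
          (raiseCoeff (-ℓ) j * raiseCoeff (-ℓ) (j - 1))) * c),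
        mul_ne_zero (inv_ne_zero (hμ0 j)) (mul_ne_zero (lowering_scalar_ne_zero ℓ j) hc), ?_⟩
      · rw [diag_h_lowering u1 u2 (hμ0 j) (hμ1 j) ih1]
        push_cast; congr 1; ring
      · rw [tensorCoeff_zero_lowering u1 u2 (hμ0 j) (hμ1 j) ih1 ih2 ih4]
        -- The formula contains E² F^j v; for j = 0 and j = 1 this vanishes for lack of powers of F,
        -- and the index j - 1 is truncated at j = 0.
        rcases j with _ | _ | j
        · simp only [map_smul, pow_zero, Module.End.one_apply, hve, map_zero, raiseCoeff]
          module
        · simp only [map_smul, zero_add, pow_zero, pow_succ, one_mul, act_xp1_xm1, hvh, hve,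
            map_zero, sub_zero, raiseCoeff, Nat.sub_self]
          module
        · simp only [map_smul, act_xp1_pow ρ hvh hve, Nat.add_sub_cancel]
          simp only [pow_succ', Module.End.mul_apply]
          module
  have hT0 : ∀ j : Fin (2 * ℓ + 1), (ρ.act xm1 ^ (j : ℕ)) v ≠ 0 := fun j => hb j ▸ b.ne_zero j
  choose c hc hcoeff using fun j : Fin (2 * ℓ + 1) => (main j).2.2.2
  have hli : LinearIndependent ℂ fun j : Fin (2 * ℓ + 1) =>
      (lowering polyRep ρ ^ (j : ℕ)) ((1 : ℂ[X]) ⊗ₜ[ℂ] v) := by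
    -- Under the constant coefficient map the family becomes the basis F^j v of V rescaled by the
    -- nonzero c_j.
    refine LinearIndependent.of_comp (tensorCoeff V 0) ?_
    have := b.linearIndependent.units_smul fun j => Units.mk0 (c j) (hc j)
    convert this using 1
    ext j
    simp [hcoeff, hb]
  have hker : ∀ u, (polyRep.tensor ρ).act xp1 u = 0 ↔ u ∈ Submodule.span ℂ
      (Set.range fun j : Fin (2 * ℓ + 1) =>
        (lowering polyRep ρ ^ (j : ℕ)) ((1 : ℂ[X]) ⊗ₜ[ℂ] v)) := by
    intro u
    constructor
    · intro hu
      -- The coefficients are forced: both sides are killed by X_α, so it suffices to match constant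
      -- coefficients, expanded in the basis F^j v.
      have e : u = ∑ j : Fin (2 * ℓ + 1), ((c j)⁻¹ * b.repr (tensorCoeff V 0 u) j) •
          (lowering polyRep ρ ^ (j : ℕ)) ((1 : ℂ[X]) ⊗ₜ[ℂ] v) := by
        rw [← sub_eq_zero]
        apply eq_zero_of_tensorCoeff_zero ρ
        · rw [map_sub, map_sum]
          simp only [map_smul, (main _).2.1, smul_zero, Finset.sum_const_zero, sub_zero]
          exact hu
        · rw [map_sub, map_sum, sub_eq_zero]
          conv_lhs => rw [← b.sum_repr (tensorCoeff V 0 u)]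
          refine Finset.sum_congr rfl fun j _ => ?_
          rw [map_smul, hcoeff, hb, smul_smul]
          congr 1
          field_simp [hc j]
      rw [e]
      exact Submodule.sum_mem _ fun j _ => Submodule.smul_mem _ _ (Submodule.subset_span ⟨j, rfl⟩)
    · intro hu
      refine (Submodule.span_le (p := LinearMap.ker ((polyRep.tensor ρ).act xp1))).2 ?_ hu
      rintro _ ⟨j, rfl⟩
      exact (main j).2.1
  simp only [orbit_envNMinus_eq_cyclicSpan]
  refine ⟨trivial, u1, u2, fun j => ⟨hli.ne_zero j, (isPrimitive_iff _ _).2 (main j).2.1, ?_⟩,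
    isInternal_cyclicSpan _ hnil hli (fun j => (main j).1) hker fun j => hμ j⟩
  obtain ⟨k, hk⟩ := (main j).2.2.1
  exact isIrreducibleSubrep_cyclicSpan _ hnil hk (hli.ne_zero j) (main j).1 (main j).2.1 (hμ j)
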